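/- Let $m\ge 146$ and $\lambda=\sqrt{1+m^2}-m$. For a function $\sigma$ on $\mathbb R$ write $\sigma(p)$, $p=-i\,d/dx$, for the Fourier multiplier on functions on $\mathbb R$ with symbol $\sigma(k)$. Put $$g(x)=2x-\sin 2x,\qquad h(x)=\frac1{1+g(x)^2},\qquad f=\Big(\sqrt{(p+1)^2+m^2}+\sqrt{(p-1)^2+m^2}\Big)h,\qquad u(x)=f(x)\sin x,$$ $$V(x)=\lambda-\frac{1}{u(x)}\Big(\big(\sqrt{p^2+m^2}-m\big)u\Big)(x)\quad\text{where }u(x)\ne0,$$ and extend $V$ by its limit to the zeros of $u$. Then $V$ is well defined: $u(x)=0$ exactly when $x\in\pi\mathbb Z$, and the extended $V$ is a continuous real-valued function on $\mathbb R$. Let $W(x)=V(|x|)$ for $x\in\mathbb R^3$ and $$H_{\rm r}=\sqrt{-\Delta+m^2}-m+W\quad\text{on }L^2(\mathbb R^3),$$ where $\sqrt{-\Delta+m^2}-m$ is defined by the Fourier transform on its maximal domain, $W$ acts by multiplication on its maximal domain, and $D(H_{\rm r})$ is the intersection of the two domains. Then $$v(x)=\frac{u(|x|)}{\sqrt{4\pi}\,|x|}$$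 is a nonzero element of $L^2(\mathbb R^3)$, lies in $D(H_{\rm r})$, and satisfies $H_{\rm r}v=\lambda v$. -/

import Mathlib

open Real MeasureTheory Filter Topology
open scoped FourierTransform ENNReal

noncomputable section

namespace RelSchrodinger

/-! ### Operators on `L²` -/

/-- The (maximal) operator of multiplication by `M` on `L²(μ)`, with domain
`{ψ ∈ L² : M ψ ∈ L²}`. -/
def mulOp {α : Type*} [MeasurableSpace α] (μ : Measure α) (M : α → ℂ) :
    Lp ℂ 2 μ →ₗ.[ℂ] Lp ℂ 2 μ where
  domain :=
    { carrier := {ψ | MemLp (fun x => M x * ψ x) 2 μ}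
      add_mem' := by
        intro a b ha hb
        refine (MemLp.add ha hb).ae_eq ?_
        filter_upwards [Lp.coeFn_add a b] with x hx
        simp only [hx, Pi.add_apply, mul_add]
      zero_mem' := by
        refine (MemLp.zero (ε := ℂ) (p := 2) (μ := μ)).ae_eq ?_
        filter_upwards [Lp.coeFn_zero ℂ 2 μ] with x hx
        simp only [hx, Pi.zero_apply, mul_zero]
      smul_mem' := by
        intro c a ha
        refine (MemLp.const_smul ha c).ae_eq ?_
        filter_upwards [Lp.coeFn_smul c a] with x hx
        simp only [hx, Pi.smul_apply, smul_eq_mul]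
        ring }
  toFun :=
    { toFun := fun ψ => MemLp.toLp (fun x => M x * (ψ : Lp ℂ 2 μ) x) ψ.2
      map_add' := by
        intro a b
        rw [← MemLp.toLp_add]
        refine (MemLp.toLp_eq_toLp_iff _ _).2 ?_
        filter_upwards [Lp.coeFn_add (a : Lp ℂ 2 μ) (b : Lp ℂ 2 μ)] with x hx
        simp only [Submodule.coe_add, hx, Pi.add_apply, mul_add]
      map_smul' := by
        intro c a
        rw [RingHom.id_apply, ← MemLp.toLp_const_smul]
        refine (MemLp.toLp_eq_toLp_iff _ _).2 ?_
        filter_upwards [Lp.coeFn_smul c (a : Lp ℂ 2 μ)] with x hx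
        simp only [Submodule.coe_smul, hx, Pi.smul_apply, smul_eq_mul]
        ring }

/-- Three-dimensional Euclidean space. -/
abbrev R3 : Type := EuclideanSpace ℝ (Fin 3)

/-- `L²(ℝ³)`. -/
abbrev L2R3 : Type := Lp ℂ 2 (volume : Measure R3)

/-- The `L²` Fourier transform on `ℝ³`, with kernel `exp (-2 π i ⟪x, ξ⟫)`. -/
def fourierL2 : L2R3 ≃ₗ[ℂ] L2R3 := (Lp.fourierTransformₗᵢ R3 ℂ).toLinearEquiv

/-- The kinetic energy `√(-Δ + m²) - m` on `L²(ℝ³)`: the self-adjoint operator `𝓕⁻¹ M 𝓕`, where `M`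
is the maximal multiplication operator by `√(|2πξ|² + m²) - m`. Its domain is
`{ψ ∈ L² : (√(|2πξ|² + m²) - m) (𝓕 ψ)(ξ) ∈ L²}`. -/
def kinetic (m : ℝ) : L2R3 →ₗ.[ℂ] L2R3 :=
  let M := mulOp (volume : Measure R3)
    (fun ξ => ((√((2 * π * ‖ξ‖) ^ 2 + m ^ 2) - m : ℝ) : ℂ))
  { domain := M.domain.comap fourierL2.toLinearMap
    toFun := fourierL2.symm.toLinearMap ∘ₗ M.toFun ∘ₗ
      (fourierL2.toLinearMap.restrict (p := M.domain.comap fourierL2.toLinearMap)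
        (q := M.domain) (fun _ hψ => hψ)) }

/-! ### The one-dimensional construction -/

/-- `(σ(p) φ)(x)` with `p = -i d/dx`, for functions on the line for which the Fourier integrals
converge: `σ(p) φ` is the inverse Fourier transform of `σ(2πξ) (𝓕 φ)(ξ)`, since `p` corresponds to
`2πξ` in the convention `𝓕 φ ξ = ∫ exp (-2 π i x ξ) φ x dx`. -/
def symbolOp (σ : ℝ → ℝ) (φ : ℝ → ℂ) : ℝ → ℂ :=
  𝓕⁻ (fun ξ : ℝ => (σ (2 * π * ξ) : ℂ) * 𝓕 φ ξ)

/-- `g(x) = 2x - sin 2x`. -/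
def g (x : ℝ) : ℝ := 2 * x - sin (2 * x)

/-- `h(x) = 1 / (1 + g(x)²)`. -/
def h (x : ℝ) : ℝ := 1 / (1 + g x ^ 2)

/-- `f = (√((p+1)² + m²) + √((p-1)² + m²)) h`. -/
def f (m : ℝ) : ℝ → ℂ :=
  symbolOp (fun k => √((k + 1) ^ 2 + m ^ 2) + √((k - 1) ^ 2 + m ^ 2)) (fun x => (h x : ℂ))

/-- `u(x) = f(x) sin x`. -/
def u (m : ℝ) (x : ℝ) : ℂ := f m x * (sin x : ℂ)

/-- `(√(p² + m²) - m) u`. -/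
def kineticU (m : ℝ) : ℝ → ℂ := symbolOp (fun k => √(k ^ 2 + m ^ 2) - m) (u m)

/-- `λ = √(1 + m²) - m`. -/
def eigenval (m : ℝ) : ℝ := √(1 + m ^ 2) - m

/-- `V = λ - (1/u) (√(p² + m²) - m) u`, extended by its limit to the zeros of `u`. -/
def V (m : ℝ) (x : ℝ) : ℂ :=
  if u m x = 0 then
    limUnder (𝓝[≠] x) (fun y => (eigenval m : ℂ) - kineticU m y / u m y)
  else (eigenval m : ℂ) - kineticU m x / u m x

/-! ### The three-dimensional operator -/

/-- `W(x) = V(|x|)` on `ℝ³`. -/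
def W (m : ℝ) (x : R3) : ℂ := V m ‖x‖

/-- `v(x) = u(|x|) / (√(4π) |x|)` on `ℝ³`. -/
def v (m : ℝ) (x : R3) : ℂ := u m ‖x‖ / ((√(4 * π) * ‖x‖ : ℝ) : ℂ)

/-- `H_r = √(-Δ + m²) - m + W` on `L²(ℝ³)`, as a sum of unbounded operators: its domain is the
intersection of the domains of the summands. -/
def Hr (m : ℝ) : L2R3 →ₗ.[ℂ] L2R3 := kinetic m + mulOp volume (W m)

end RelSchrodinger

end

namespace RelSchrodinger

/-! ### The `L²` Fourier transform of integrable functions -/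

/-! Write A and B for √((p+1)²+m²) and √((p-1)²+m²). Conjugation by e^{±ix} turns √(p²+m²) into A
and B, so √(p²+m²)u = (e^{ix} A f - e^{-ix} B f)/(2i). Since f = (A+B)h and A² - B² = 4p, one has A
f = ½(A+B)f + 2ph and B f = ½(A+B)f - 2ph, whence √(p²+m²)u = sin x · ½(A+B)f - 2 cos x · h'. The
function g is chosen so that g' = 4 sin² x: then h' = -8 sin² x · g h², and the right side is sin x
times a continuous function (`kineticU_eq`). Dividing by u = f sin x cancels the sine, so V is
continuous once f has no zeros (`V_eq`).

Positivity of f (`fReal_pos`) is probabilistic. If Z is 1/m times a product of two independent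
standard Gaussians, then 1/√(k²+m²) = m⁻¹ E e^{ikZ}; as e^{ipZ} is a translation, f(x) becomes an
average of explicit combinations of h, h', h'' at x + Z (`symbolOp_sqrt_shift`, `f_eq_fReal`). These
derivatives are bounded by multiples of h, and h(x+Z) differs from h(x) by a small relative amount
because E Z² = 1/m². For large m the term m² h(x) dominates. The same average gives |f| ≤ C h, hence
integrability of f and u and the validity of Fourier inversion.

The passage to ℝ³ rests on `fourierInv_radial`: for odd w, the three-dimensional inverse transform
of w(|ξ|)/|ξ| is -i times (𝓕⁻w)(|x|)/|x|. Radial multipliers on ℝ³ therefore act on u(|x|)/|x| as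
their one-dimensional versions act on u, and the line identity V u = λu - (√(p²+m²) - m)u becomes
the eigenvalue equation. -/

theorem fourierInv_toLp_ae_eq {E : Type*} [NormedAddCommGroup E] [MeasurableSpace E]
    [BorelSpace E] [InnerProductSpace ℝ E] [FiniteDimensional ℝ E] {φ : E → ℂ}
    (h1 : Integrable φ) (h2 : MemLp φ 2) :
    ((𝓕⁻ (h2.toLp φ) : Lp ℂ 2 (volume : Measure E)) : E → ℂ) =ᵐ[volume] 𝓕⁻ φ := by
  have hcont : Continuous (𝓕⁻ φ) := by
    have : 𝓕⁻ φ = fun x => 𝓕 φ (-x) := by ext x; exact fourierInv_eq_fourier_neg φ x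
    rw [this]
    exact (VectorFourier.fourierIntegral_continuous Real.continuous_fourierChar
      (by exact continuous_inner) h1).comp continuous_neg
  -- Both sides are compared against smooth compactly supported test functions. The `L²` transform
  -- is the distributional one, so it moves onto the test function, and Fubini moves it back onto
  -- the integrable φ.
  refine ae_eq_of_integral_contDiff_smul_eq
    ((Lp.memLp (𝓕⁻ (h2.toLp φ) : Lp ℂ 2 (volume : Measure E))).locallyIntegrable (by norm_num))
    hcont.locallyIntegrable ?_
  intro k hk hks
  have hks' : HasCompactSupport (fun x => (k x : ℂ)) := hks.comp_left Complex.ofReal_zero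
  have hk' : ContDiff ℝ (⊤ : ℕ∞) (fun x => (k x : ℂ)) := Complex.ofRealCLM.contDiff.comp hk
  set ψ := hks'.toSchwartzMap hk' with hψ
  have hψk : ∀ x, ψ x = (k x : ℂ) := fun x => rfl
  have key := congrArg (fun T => T ψ) (Lp.fourierInv_toTemperedDistribution_eq (h2.toLp φ))
  simp only [TemperedDistribution.fourierInv_apply, Lp.toTemperedDistribution_apply] at key
  calc ∫ x, k x • (𝓕⁻ (h2.toLp φ) : Lp ℂ 2 (volume : Measure E)) x
      = ∫ x, ψ x • (𝓕⁻ (h2.toLp φ) : Lp ℂ 2 (volume : Measure E)) x := by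
        simp [hψk]
    _ = ∫ x, (𝓕⁻ ψ) x • (h2.toLp φ) x := key.symm
    _ = ∫ x, 𝓕⁻ (ψ : E → ℂ) x • φ x := by
        refine integral_congr_ae ?_
        filter_upwards [h2.coeFn_toLp] with x hx
        rw [hx, SchwartzMap.fourierInv_coe]
    _ = ∫ x, ψ x • 𝓕⁻ φ x := by
        have := VectorFourier.integral_fourierIntegral_smul_eq_flip (L := -innerₗ E)
          (μ := volume) (ν := volume) (f := ψ) (g := φ) Real.continuous_fourierChar
          (by exact (continuous_inner (𝕜 := ℝ) (E := E)).neg) ψ.integrable h1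
        rw [show (-innerₗ E).flip = -innerₗ E by ext; simp [real_inner_comm]] at this
        exact this
    _ = ∫ x, k x • 𝓕⁻ φ x := by simp [hψk]

/-! ### Inverse Fourier transforms of radial functions on `ℝ³` -/

/-- Euclidean space `ℝ³` as the product of an axis and a Euclidean plane. -/
noncomputable def axisPlaneEquiv : R3 ≃ᵐ ℝ × EuclideanSpace ℝ (Fin 2) :=
  ((MeasurableEquiv.toLp 2 (Fin 3 → ℝ)).symm.trans
    (MeasurableEquiv.piFinSuccAbove (fun _ => ℝ) 0)).trans
    (MeasurableEquiv.prodCongr (MeasurableEquiv.refl ℝ)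
      (MeasurableEquiv.toLp 2 (Fin 2 → ℝ)))

theorem measurePreserving_axisPlaneEquiv : MeasurePreserving axisPlaneEquiv :=
  ((MeasurePreserving.id volume).prod
    (PiLp.volume_preserving_toLp (Fin 2))).comp
    ((volume_preserving_piFinSuccAbove (fun _ : Fin 3 => ℝ) 0).comp
      (PiLp.volume_preserving_ofLp (Fin 3)))

theorem axisPlaneEquiv_fst (ξ : R3) : (axisPlaneEquiv ξ).1 = ξ 0 := rfl

theorem norm_eq_sqrt_axisPlaneEquiv (ξ : R3) :
    ‖ξ‖ = √((axisPlaneEquiv ξ).1 ^ 2 + ‖(axisPlaneEquiv ξ).2‖ ^ 2) := by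
  rw [EuclideanSpace.norm_eq, EuclideanSpace.norm_sq_eq, Fin.sum_univ_succ]
  simp only [Real.norm_eq_abs, sq_abs]
  rfl

theorem integral_plane_radial (Φ : ℝ → ℂ) :
    ∫ y : EuclideanSpace ℝ (Fin 2), Φ ‖y‖ = 2 * π * ∫ ρ in Set.Ioi (0 : ℝ), (ρ : ℂ) * Φ ρ := by
  rw [integral_fun_norm_addHaar]
  have : (volume : Measure (EuclideanSpace ℝ (Fin 2))).real (Metric.ball 0 1) = π := by
    rw [Measure.real, EuclideanSpace.volume_ball_fin_two]
    simp [Real.pi_pos.le]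
  rw [this]
  simp [mul_assoc]

/-- The primitive of `-w` that vanishes at infinity. -/
noncomputable def tail (w : ℝ → ℂ) (z : ℝ) : ℂ := (∫ s in Set.Ioi (0 : ℝ), w s) - ∫ s in (0 : ℝ)..z, w s

theorem hasDerivAt_tail {w : ℝ → ℂ} (hc : Continuous w) (z : ℝ) :
    HasDerivAt (tail w) (-w z) z := by
  simpa [tail, Function.comp_def] using! (hc.integral_hasStrictDerivAt 0 z).hasDerivAt.const_sub
    (∫ s in Set.Ioi (0 : ℝ), w s)

theorem tendsto_tail {w : ℝ → ℂ} (hi : Integrable w) : Tendsto (tail w) atTop (𝓝 0) := by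
  simpa [tail] using! (intervalIntegral_tendsto_integral_Ioi 0 hi.integrableOn tendsto_id).const_sub
    (∫ s in Set.Ioi (0 : ℝ), w s)

theorem tail_neg {w : ℝ → ℂ} (hodd : ∀ s, w (-s) = -w s) (z : ℝ) : tail w (-z) = tail w z := by
  have := intervalIntegral.integral_comp_neg (f := w) (a := 0) (b := z)
  simp only [hodd, intervalIntegral.integral_neg, neg_zero] at this
  rw [tail, tail, intervalIntegral.integral_symm, ← this, neg_neg]

theorem tail_abs {w : ℝ → ℂ} (hodd : ∀ s, w (-s) = -w s) (z : ℝ) : tail w |z| = tail w z := by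
  rcases abs_choice z with h | h <;> rw [h]
  exact tail_neg hodd z

/-- In polar coordinates on the plane, s = √(z²+ρ²) satisfies s ds = ρ dρ, so the integral is 2π ∫ w
over (|z|, ∞). Oddness of w makes `tail w` even, which removes the absolute value. -/
theorem integral_plane_shell {w : ℝ → ℂ} (hc : Continuous w) (hodd : ∀ s, w (-s) = -w s)
    (hi : Integrable w) {z : ℝ} (hz : z ≠ 0)
    (hint : Integrable (fun y : EuclideanSpace ℝ (Fin 2) =>
      w √(z ^ 2 + ‖y‖ ^ 2) / (√(z ^ 2 + ‖y‖ ^ 2) : ℝ))) :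
    ∫ y : EuclideanSpace ℝ (Fin 2), w √(z ^ 2 + ‖y‖ ^ 2) / (√(z ^ 2 + ‖y‖ ^ 2) : ℝ) =
      2 * π * tail w z := by
  rw [integral_plane_radial (fun ρ => w √(z ^ 2 + ρ ^ 2) / (√(z ^ 2 + ρ ^ 2) : ℝ))]
  rw [integrable_fun_norm_addHaar (volume : Measure (EuclideanSpace ℝ (Fin 2)))
    (f := fun ρ => w √(z ^ 2 + ρ ^ 2) / (√(z ^ 2 + ρ ^ 2) : ℝ))] at hint
  have hpos : ∀ ρ : ℝ, 0 < z ^ 2 + ρ ^ 2 := fun ρ => by positivity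
  have hderiv : ∀ ρ : ℝ, HasDerivAt (fun ρ => -tail w √(z ^ 2 + ρ ^ 2))
      ((ρ : ℂ) * (w √(z ^ 2 + ρ ^ 2) / (√(z ^ 2 + ρ ^ 2) : ℝ))) ρ := by
    intro ρ
    have h1 : HasDerivAt (fun ρ : ℝ => √(z ^ 2 + ρ ^ 2)) (ρ / √(z ^ 2 + ρ ^ 2)) ρ := by
      have := (((hasDerivAt_pow 2 ρ).const_add (z ^ 2)).sqrt (hpos ρ).ne')
      convert! this using 1
      field_simp
      norm_num [mul_comm]
    have h2 := ((hasDerivAt_tail hc √(z ^ 2 + ρ ^ 2)).scomp ρ h1).neg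
    convert! h2 using 1
    simp only [Complex.real_smul, Complex.ofReal_div]
    ring
  have hlim : Tendsto (fun ρ : ℝ => -tail w √(z ^ 2 + ρ ^ 2)) atTop (𝓝 (-0)) := by
    refine ((tendsto_tail hi).comp ?_).neg
    refine tendsto_atTop_mono (f := id) (fun ρ => ?_) tendsto_id
    exact Real.le_sqrt_of_sq_le (by simp only [id]; nlinarith [sq_nonneg z])
  rw [integral_Ioi_of_hasDerivAt_of_tendsto' (fun ρ _ => hderiv ρ) (by simpa using hint) hlim]
  simp [Real.sqrt_sq_eq_abs, tail_abs hodd]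

/-- After x is rotated onto an axis, the phase depends only on the axial coordinate. Integrating
over the orthogonal planes leaves 2π times the one-dimensional inverse transform of `tail w`, and
`tail w` has derivative -w. -/
theorem fourierInv_radial {w : ℝ → ℂ} (hc : Continuous w) (hodd : ∀ s, w (-s) = -w s)
    (hi : Integrable w) (h3 : Integrable (fun ξ : R3 => w ‖ξ‖ / (‖ξ‖ : ℂ))) {x : R3}
    (hx : x ≠ 0) :
    𝓕⁻ (fun ξ : R3 => w ‖ξ‖ / (‖ξ‖ : ℂ)) x = -Complex.I * (𝓕⁻ w ‖x‖ / (‖x‖ : ℂ)) := by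
  set φ : R3 → ℂ := fun ξ => w ‖ξ‖ / (‖ξ‖ : ℂ) with hφ
  set r := ‖x‖ with hr
  have hr0 : r ≠ 0 := norm_ne_zero_iff.2 hx
  set e : R3 := EuclideanSpace.single 0 r with he
  have hnorm : ‖e‖ = ‖x‖ := by simp [he, hr]
  -- The reflection in the hyperplane bisecting x and e exchanges them and fixes the radial function
  -- φ.
  have hrefl : 𝓕⁻ φ x = 𝓕⁻ φ e := by
    have h1 := fourierInv_comp_linearIsometry (Submodule.reflection (ℝ ∙ (e - x))ᗮ) φ e
    rw [Submodule.reflection_sub hnorm] at h1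
    rw [← h1]
    exact congrArg (fun k : R3 → ℂ => 𝓕⁻ k e) (funext fun ξ => by simp [hφ])
  have hinner : ∀ ξ : R3, inner ℝ ξ e = (axisPlaneEquiv ξ).1 * r := by
    intro ξ
    simp [he, axisPlaneEquiv_fst, EuclideanSpace.inner_single_right, mul_comm]
  set Φ : ℝ × EuclideanSpace ℝ (Fin 2) → ℂ :=
    fun p => w √(p.1 ^ 2 + ‖p.2‖ ^ 2) / (√(p.1 ^ 2 + ‖p.2‖ ^ 2) : ℝ) with hΦ
  have hφΦ : φ = Φ ∘ axisPlaneEquiv := by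
    ext ξ
    simp only [hφ, hΦ, Function.comp, norm_eq_sqrt_axisPlaneEquiv ξ]
  have hΦint : Integrable Φ :=
    (measurePreserving_axisPlaneEquiv.integrable_comp_emb
      axisPlaneEquiv.measurableEmbedding).1 (hφΦ ▸ h3)
  have hshell : ∀ᵐ z : ℝ, ∫ y, Φ (z, y) = 2 * π * tail w z := by
    filter_upwards [hΦint.prod_right_ae, (measure_singleton (0 : ℝ) : volume {(0 : ℝ)} = 0)
      |> compl_mem_ae_iff.2] with z hz hz0
    exact integral_plane_shell hc hodd hi hz0 hz
  -- Integrability comes from Fubini: up to the factor 2π, `tail w` is the marginal of an integrable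
  -- function.
  have htail : Integrable (tail w) := by
    have h1 : Integrable (fun z : ℝ => ∫ y, Φ (z, y)) := hΦint.integral_prod_left
    have h2 := (h1.congr hshell).const_mul (2 * π : ℂ)⁻¹
    refine h2.congr (ae_of_all _ fun z => ?_)
    have : (π : ℂ) ≠ 0 := by exact_mod_cast Real.pi_ne_zero
    field_simp
  have hexpint : Integrable (fun p : ℝ × EuclideanSpace ℝ (Fin 2) => 𝐞 (p.1 * r) • Φ p) := by
    refine (integrable_norm_iff ?_).1 ?_
    · exact (Continuous.aestronglyMeasurable (by fun_prop)).smul hΦint.1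
    · simpa [Circle.norm_smul] using hΦint.norm
  have h2 : 𝓕⁻ φ e = ∫ p : ℝ × EuclideanSpace ℝ (Fin 2), 𝐞 (p.1 * r) • Φ p := by
    rw [fourierInv_eq, ← measurePreserving_axisPlaneEquiv.integral_comp']
    refine integral_congr_ae (ae_of_all _ fun ξ => ?_)
    simp only [hinner, hφΦ, Function.comp]
  have h4 : 𝓕⁻ φ e = 2 * π * 𝓕⁻ (tail w) r := by
    rw [h2, Measure.volume_eq_prod, integral_prod _ hexpint, fourierInv_eq, ← integral_const_mul]
    refine integral_congr_ae ?_
    filter_upwards [hshell] with z hz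
    simp only [RCLike.inner_apply, conj_trivial, Circle.smul_def, smul_eq_mul, mul_comm r z]
    rw [integral_const_mul, hz]
    ring
  have h5 : 𝓕⁻ w r = 2 * π * Complex.I * r * 𝓕⁻ (tail w) r := by
    have hd : deriv (tail w) = fun z => -w z := funext fun z => (hasDerivAt_tail hc z).deriv
    have h6 := congrFun (fourier_deriv htail
      (fun z => (hasDerivAt_tail hc z).differentiableAt) (hd ▸ hi.neg)) (-r)
    have h7 : 𝓕 (fun z => -w z) (-r) = -𝓕 w (-r) := by
      simp only [fourier_eq, smul_neg, integral_neg]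
    rw [hd, h7, smul_eq_mul] at h6
    rw [fourierInv_eq_fourier_neg, fourierInv_eq_fourier_neg, ← neg_inj, h6]
    push_cast
    ring
  have hrC : (r : ℂ) ≠ 0 := by exact_mod_cast hr0
  rw [hrefl, h4, h5]
  field_simp
  rw [Complex.I_sq]
  ring

/-! ### The function `h` and its derivatives -/

theorem hasDerivAt_g (x : ℝ) : HasDerivAt g (2 - 2 * cos (2 * x)) x := by
  have h1 : HasDerivAt (fun x : ℝ => 2 * x) 2 x := by simpa using (hasDerivAt_id x).const_mul 2
  convert! h1.sub ((Real.hasDerivAt_sin (2 * x)).comp x h1) using 1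
  ring

theorem one_add_g_sq_pos (x : ℝ) : 0 < 1 + g x ^ 2 := by positivity

theorem h_pos (x : ℝ) : 0 < h x := one_div_pos.2 (one_add_g_sq_pos x)

theorem h_le_one (x : ℝ) : h x ≤ 1 := by
  rw [h, div_le_one (one_add_g_sq_pos x)]
  nlinarith [sq_nonneg (g x)]

theorem h_mul_one_add_sq (x : ℝ) : h x * (1 + g x ^ 2) = 1 :=
  one_div_mul_cancel (one_add_g_sq_pos x).ne'

theorem hasDerivAt_h (x : ℝ) :
    HasDerivAt h (h x * (-2 * (g x * h x) * (2 - 2 * cos (2 * x)))) x := by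
  have := (((hasDerivAt_g x).pow 2).const_add 1).inv (one_add_g_sq_pos x).ne'
  have h2 : h = fun x => (1 + g x ^ 2)⁻¹ := by ext; simp [h]
  have hx : h x = (1 + g x ^ 2)⁻¹ := congrFun h2 x
  rw [hx, h2]
  convert! this using 1
  simp only [Nat.cast_ofNat, Nat.add_one_sub_one, pow_one, div_eq_mul_inv, Pi.pow_apply, ← inv_pow]
  ring

theorem abs_g_mul_h_le (x : ℝ) : |g x * h x| ≤ 1 / 2 := by
  rw [abs_mul, abs_of_pos (h_pos x), h, mul_one_div, div_le_iff₀ (one_add_g_sq_pos x), ← sq_abs]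
  nlinarith [sq_nonneg (|g x| - 1)]

theorem g_odd (x : ℝ) : g (-x) = -g x := by
  simp only [g, mul_neg, sin_neg]
  ring

/-- The algebra of functions generated by `sin 2x`, `cos 2x`, `h` and `g h`. -/
noncomputable def derivAlg : Subalgebra ℝ (ℝ → ℝ) :=
  Algebra.adjoin ℝ {fun x => sin (2 * x), fun x => cos (2 * x), h, fun x => g x * h x}

theorem sin_mem_derivAlg : (fun x => sin (2 * x)) ∈ derivAlg :=
  Algebra.subset_adjoin (by simp)
theorem cos_mem_derivAlg : (fun x => cos (2 * x)) ∈ derivAlg :=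
  Algebra.subset_adjoin (by simp)
theorem h_mem_derivAlg : h ∈ derivAlg :=
  Algebra.subset_adjoin (by simp)
theorem gh_mem_derivAlg : (fun x => g x * h x) ∈ derivAlg :=
  Algebra.subset_adjoin (by simp)

theorem const_mem_derivAlg (c : ℝ) : (fun _ => c) ∈ derivAlg :=
  derivAlg.algebraMap_mem c

theorem dlog_mem_derivAlg :
    (fun x => -2 * (g x * h x) * (2 - 2 * cos (2 * x))) ∈ derivAlg :=
  derivAlg.mul_mem (derivAlg.mul_mem (const_mem_derivAlg (-2)) gh_mem_derivAlg)
    (derivAlg.sub_mem (const_mem_derivAlg 2)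
      (derivAlg.mul_mem (const_mem_derivAlg 2) cos_mem_derivAlg))

theorem exists_bound_of_mem_derivAlg {b : ℝ → ℝ} (hb : b ∈ derivAlg) : ∃ C, ∀ x, |b x| ≤ C := by
  refine Algebra.adjoin_induction (p := fun b _ => ∃ C, ∀ x, |b x| ≤ C) ?_ ?_ ?_ ?_ hb
  · rintro b (rfl | rfl | rfl | rfl)
    · exact ⟨1, fun x => abs_sin_le_one _⟩
    · exact ⟨1, fun x => abs_cos_le_one _⟩
    · exact ⟨1, fun x => (abs_of_pos (h_pos x)).trans_le (h_le_one x)⟩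
    · exact ⟨1 / 2, abs_g_mul_h_le⟩
  · exact fun r => ⟨|r|, fun x => le_rfl⟩
  · rintro a b _ _ ⟨A, hA⟩ ⟨B, hB⟩
    exact ⟨A + B, fun x => (abs_add_le _ _).trans (add_le_add (hA x) (hB x))⟩
  · rintro a b _ _ ⟨A, hA⟩ ⟨B, hB⟩
    refine ⟨A * B, fun x => ?_⟩
    rw [Pi.mul_apply, abs_mul]
    exact mul_le_mul (hA x) (hB x) (abs_nonneg _) ((abs_nonneg _).trans (hA x))

theorem exists_hasDerivAt_of_mem_derivAlg {b : ℝ → ℝ} (hb : b ∈ derivAlg) :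
    ∃ b' ∈ derivAlg, ∀ x, HasDerivAt b (b' x) x := by
  refine Algebra.adjoin_induction
    (p := fun b _ => ∃ b' ∈ derivAlg, ∀ x, HasDerivAt b (b' x) x) ?_ ?_ ?_ ?_ hb
  · have h2 : ∀ x : ℝ, HasDerivAt (fun x : ℝ => 2 * x) 2 x := fun x => by
      simpa using (hasDerivAt_id x).const_mul 2
    rintro b (rfl | rfl | rfl | rfl)
    · exact ⟨_, derivAlg.mul_mem cos_mem_derivAlg (const_mem_derivAlg 2),
        fun x => (Real.hasDerivAt_sin (2 * x)).comp x (h2 x)⟩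
    · exact ⟨_, derivAlg.mul_mem (derivAlg.neg_mem sin_mem_derivAlg) (const_mem_derivAlg 2),
        fun x => (Real.hasDerivAt_cos (2 * x)).comp x (h2 x)⟩
    · exact ⟨_, derivAlg.mul_mem h_mem_derivAlg dlog_mem_derivAlg, hasDerivAt_h⟩
    · refine ⟨fun x => (2 - 2 * cos (2 * x)) * h x +
          (g x * h x) * (-2 * (g x * h x) * (2 - 2 * cos (2 * x))), ?_, fun x => ?_⟩
      · exact derivAlg.add_mem (derivAlg.mul_mem (derivAlg.sub_mem (const_mem_derivAlg 2)
          (derivAlg.mul_mem (const_mem_derivAlg 2) cos_mem_derivAlg)) h_mem_derivAlg)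
          (derivAlg.mul_mem gh_mem_derivAlg dlog_mem_derivAlg)
      · convert! (hasDerivAt_g x).mul (hasDerivAt_h x) using 1
        ring
  · exact fun r => ⟨fun _ => 0, const_mem_derivAlg 0, fun x => hasDerivAt_const x r⟩
  · rintro a b _ _ ⟨a', ha', ha⟩ ⟨b', hb', hb⟩
    exact ⟨a' + b', derivAlg.add_mem ha' hb', fun x => (ha x).add (hb x)⟩
  · rintro a b ha₀ hb₀ ⟨a', ha', ha⟩ ⟨b', hb', hb⟩
    exact ⟨a' * b + a * b', derivAlg.add_mem (derivAlg.mul_mem ha' hb₀)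
      (derivAlg.mul_mem ha₀ hb'), fun x => (ha x).mul (hb x)⟩

theorem contDiff_h : ContDiff ℝ (⊤ : ℕ∞) h := by
  have : ContDiff ℝ (⊤ : ℕ∞) g := by unfold g; fun_prop
  exact contDiff_const.div (contDiff_const.add (this.pow 2)) fun x => (one_add_g_sq_pos x).ne'

theorem continuous_h : Continuous h := contDiff_h.continuous

theorem continuous_iteratedDeriv_h (n : ℕ) : Continuous (iteratedDeriv n h) :=
  contDiff_h.continuous_iteratedDeriv n (by exact_mod_cast le_top)

/-- The algebra is closed under differentiation and contains h'/h, so each derivative of b h is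
again of this form. The generator g h replaces g, which is unbounded. -/
theorem exists_iteratedDeriv_h (n : ℕ) :
    ∃ b ∈ derivAlg, ∀ x, iteratedDeriv n h x = b x * h x := by
  induction n with
  | zero => exact ⟨1, derivAlg.one_mem, fun x => by simp⟩
  | succ n ih =>
    obtain ⟨b, hb, hbh⟩ := ih
    obtain ⟨b', hb', hd⟩ := exists_hasDerivAt_of_mem_derivAlg hb
    refine ⟨_, derivAlg.add_mem hb' (derivAlg.mul_mem hb dlog_mem_derivAlg), fun x => ?_⟩
    rw [iteratedDeriv_succ, funext hbh]
    refine ((hd x).mul (hasDerivAt_h x)).deriv.trans ?_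
    simp only [Pi.add_apply, Pi.mul_apply]
    ring

theorem exists_iteratedDeriv_h_le (n : ℕ) : ∃ C, ∀ x, |iteratedDeriv n h x| ≤ C * h x := by
  obtain ⟨b, hb, hbh⟩ := exists_iteratedDeriv_h n
  obtain ⟨C, hC⟩ := exists_bound_of_mem_derivAlg hb
  refine ⟨C, fun x => ?_⟩
  rw [hbh, abs_mul, abs_of_pos (h_pos x)]
  exact mul_le_mul_of_nonneg_right (hC x) (h_pos x).le

theorem h_le (x : ℝ) : h x ≤ 2 * (1 + x ^ 2)⁻¹ := by
  rw [h, ← div_eq_mul_inv, div_le_div_iff₀ (one_add_g_sq_pos x) (by positivity)]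
  have h1 : 2 * |x| - 1 ≤ |g x| := by
    have h2 : |2 * x| ≤ |g x| + |sin (2 * x)| := by
      refine (abs_add_le _ _).trans' (le_of_eq ?_)
      congr 1
      simp [g]
    have := abs_sin_le_one (2 * x)
    rw [abs_mul, abs_two] at h2
    linarith
  rw [← sq_abs x, ← sq_abs (g x)]
  have h0 := abs_nonneg x
  have h0' := abs_nonneg (g x)
  rcases le_or_gt |x| (1 / 2) with hx | hx
  · nlinarith
  -- With |g| ≥ 2|x| - 1 the claim reduces to 7x² - 8|x| + 3 ≥ 0, and seven times the left side is
  -- (7|x| - 4)² + 5.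
  · nlinarith [mul_self_le_mul_self (by linarith : 0 ≤ 2 * |x| - 1) h1,
      sq_nonneg (7 * |x| - 4)]

theorem integrable_h : Integrable h :=
  (integrable_inv_one_add_sq.const_mul 2).mono' continuous_h.aestronglyMeasurable
    (ae_of_all _ fun x => by
      rw [Real.norm_eq_abs, abs_of_pos (h_pos x)]
      exact h_le x)

theorem integrable_iteratedDeriv_h (n : ℕ) : Integrable (iteratedDeriv n h) := by
  obtain ⟨C, hC⟩ := exists_iteratedDeriv_h_le n
  exact (integrable_h.const_mul C).mono'
    (continuous_iteratedDeriv_h n).aestronglyMeasurable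
    (ae_of_all _ hC)

/-! ### Rapidly decaying functions -/

/-- Continuous functions decaying faster than every power. -/
structure RapidDecay (φ : ℝ → ℂ) : Prop where
  continuous : Continuous φ
  bound : ∀ n : ℕ, ∃ C, ∀ ξ, (1 + ξ ^ 2) ^ n * ‖φ ξ‖ ≤ C

namespace RapidDecay

variable {φ ψ : ℝ → ℂ}

theorem sub (hφ : RapidDecay φ) (hψ : RapidDecay ψ) : RapidDecay fun ξ => φ ξ - ψ ξ := by
  refine ⟨hφ.continuous.sub hψ.continuous, fun n => ?_⟩
  obtain ⟨A, hA⟩ := hφ.bound n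
  obtain ⟨B, hB⟩ := hψ.bound n
  refine ⟨A + B, fun ξ => ?_⟩
  have h1 : 0 ≤ (1 + ξ ^ 2) ^ n := by positivity
  calc (1 + ξ ^ 2) ^ n * ‖φ ξ - ψ ξ‖ ≤ (1 + ξ ^ 2) ^ n * (‖φ ξ‖ + ‖ψ ξ‖) := by
        gcongr; exact norm_sub_le _ _
    _ ≤ A + B := by rw [mul_add]; exact add_le_add (hA ξ) (hB ξ)

/-- No smoothness of the symbol is required, only continuity and polynomial growth; this is all that
the square-root symbols need. -/
theorem mul (hφ : RapidDecay φ) {a : ℝ → ℂ} (ha : Continuous a) {K : ℝ} {k : ℕ}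
    (hK : ∀ ξ, ‖a ξ‖ ≤ K * (1 + ξ ^ 2) ^ k) : RapidDecay fun ξ => a ξ * φ ξ := by
  refine ⟨ha.mul hφ.continuous, fun n => ?_⟩
  obtain ⟨A, hA⟩ := hφ.bound (n + k)
  have hK0 : 0 ≤ K := by simpa using (norm_nonneg _).trans (hK 0)
  refine ⟨K * A, fun ξ => ?_⟩
  calc (1 + ξ ^ 2) ^ n * ‖a ξ * φ ξ‖
      ≤ (1 + ξ ^ 2) ^ n * (K * (1 + ξ ^ 2) ^ k * ‖φ ξ‖) := by
        rw [norm_mul]; gcongr; exact hK ξ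
    _ = K * ((1 + ξ ^ 2) ^ (n + k) * ‖φ ξ‖) := by ring
    _ ≤ K * A := by gcongr; exact hA ξ

theorem const_mul (hφ : RapidDecay φ) (c : ℂ) : RapidDecay fun ξ => c * φ ξ :=
  hφ.mul continuous_const (K := ‖c‖) (k := 0) (by simp)

theorem add (hφ : RapidDecay φ) (hψ : RapidDecay ψ) : RapidDecay fun ξ => φ ξ + ψ ξ := by
  simpa using hφ.sub (hψ.const_mul (-1))

/-- Peetre's inequality: 1 + ξ² ≤ 2(1 + a²)(1 + (ξ+a)²). -/
theorem comp_add (hφ : RapidDecay φ) (a : ℝ) : RapidDecay fun ξ => φ (ξ + a) := by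
  refine ⟨by have := hφ.continuous; fun_prop, fun n => ?_⟩
  obtain ⟨A, hA⟩ := hφ.bound n
  refine ⟨(2 * (1 + a ^ 2)) ^ n * A, fun ξ => ?_⟩
  calc (1 + ξ ^ 2) ^ n * ‖φ (ξ + a)‖
      ≤ (2 * (1 + a ^ 2) * (1 + (ξ + a) ^ 2)) ^ n * ‖φ (ξ + a)‖ := by
        gcongr
        nlinarith [sq_nonneg (ξ + 2 * a), mul_nonneg (sq_nonneg a) (sq_nonneg (ξ + a))]
    _ = (2 * (1 + a ^ 2)) ^ n * ((1 + (ξ + a) ^ 2) ^ n * ‖φ (ξ + a)‖) := by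
        rw [mul_pow, mul_assoc]
    _ ≤ _ := by gcongr; exact hA _

theorem norm_le (hφ : RapidDecay φ) (n : ℕ) : ∃ C, 0 ≤ C ∧ ∀ ξ, ‖φ ξ‖ ≤ C * ((1 + ξ ^ 2) ^ n)⁻¹ := by
  obtain ⟨C, hC⟩ := hφ.bound n
  refine ⟨C, (by positivity : (0 : ℝ) ≤ (1 + 0 ^ 2) ^ n * ‖φ 0‖).trans (hC 0), fun ξ => ?_⟩
  rw [← div_eq_mul_inv, le_div_iff₀ (by positivity), mul_comm]
  exact hC ξ

theorem integrable (hφ : RapidDecay φ) : Integrable φ := by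
  obtain ⟨C, -, hC⟩ := hφ.norm_le 1
  exact (integrable_inv_one_add_sq.const_mul C).mono' hφ.continuous.aestronglyMeasurable
    (ae_of_all _ fun ξ => by simpa using hC ξ)

end RapidDecay

/-- Every derivative of h is integrable, so (2πiξ)ᵏ 𝓕h is bounded for every k. -/
theorem rapidDecay_fourier_h : RapidDecay (𝓕 fun x => (h x : ℂ)) := by
  have hi : ∀ n : ℕ, Integrable (iteratedDeriv n fun x => (h x : ℂ)) := by
    intro n
    have : (iteratedDeriv n fun x => (h x : ℂ)) = fun x => ((iteratedDeriv n h x : ℝ) : ℂ) := by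
      induction n with
      | zero => simp
      | succ n ih =>
        rw [iteratedDeriv_succ, ih]
        ext x
        have hd : Differentiable ℝ (iteratedDeriv n h) :=
          contDiff_h.differentiable_iteratedDeriv n (by exact_mod_cast ENat.natCast_lt_top n)
        rw [iteratedDeriv_succ]
        exact ((hd x).hasDerivAt.ofReal_comp).deriv
    rw [this]
    exact (integrable_iteratedDeriv_h n).ofReal
  have h0 : Integrable fun x => (h x : ℂ) := by simpa using hi 0
  have hsmooth : ContDiff ℝ (⊤ : ℕ∞) fun x => (h x : ℂ) :=
    Complex.ofRealCLM.contDiff.comp contDiff_h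
  refine ⟨VectorFourier.fourierIntegral_continuous Real.continuous_fourierChar
    (by exact continuous_inner) h0, fun n => ?_⟩
  have hb : ∀ k : ℕ, ∃ C, ∀ ξ : ℝ, |ξ| ^ k * ‖𝓕 (fun x => (h x : ℂ)) ξ‖ ≤ C := by
    intro k
    refine ⟨∫ x, ‖iteratedDeriv k (fun x => (h x : ℂ)) x‖, fun ξ => ?_⟩
    have h1 := congrFun (fourier_iteratedDeriv hsmooth (fun n _ => hi n) (n := k) le_top) ξ
    have h2 : ‖𝓕 (iteratedDeriv k fun x => (h x : ℂ)) ξ‖ ≤ _ :=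
      VectorFourier.norm_fourierIntegral_le_integral_norm 𝐞 volume (innerₗ ℝ) _ ξ
    refine h2.trans' ?_
    rw [h1, norm_smul, norm_pow]
    gcongr
    simp only [norm_mul, Complex.norm_I, Complex.norm_real, Real.norm_eq_abs, abs_of_pos pi_pos]
    norm_num
    nlinarith [pi_gt_three, abs_nonneg ξ]
  obtain ⟨A, hA⟩ := hb 0
  obtain ⟨B, hB⟩ := hb (2 * n)
  refine ⟨2 ^ (n - 1) * (A + B), fun ξ => ?_⟩
  have h1 := add_pow_le (zero_le_one (α := ℝ)) (sq_nonneg ξ) n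
  calc (1 + ξ ^ 2) ^ n * ‖𝓕 (fun x => (h x : ℂ)) ξ‖
      ≤ 2 ^ (n - 1) * (1 ^ n + (ξ ^ 2) ^ n) * ‖𝓕 (fun x => (h x : ℂ)) ξ‖ := by gcongr
    _ = 2 ^ (n - 1) * (|ξ| ^ 0 * ‖𝓕 (fun x => (h x : ℂ)) ξ‖ +
          |ξ| ^ (2 * n) * ‖𝓕 (fun x => (h x : ℂ)) ξ‖) := by
        rw [pow_mul |ξ|, sq_abs]; ring
    _ ≤ _ := by gcongr; exacts [hA ξ, hB ξ]

/-! ### `1 / √(k² + m²)` as the characteristic function of a product of Gaussian variables -/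

open ProbabilityTheory

/-- The law of two independent standard Gaussian variables. -/
noncomputable def gaussianPair : Measure (ℝ × ℝ) := (gaussianReal 0 1).prod (gaussianReal 0 1)

instance : IsProbabilityMeasure gaussianPair := by
  unfold gaussianPair
  infer_instance

/-- Conditioning on the first variable y gives the Gaussian characteristic function e^{-k²y²/2};
averaging it over y is a Gaussian integral. -/
theorem integral_cexp_gaussianPair (k : ℝ) :
    ∫ p, Complex.exp ((k * (p.1 * p.2) : ℝ) * Complex.I) ∂gaussianPair =
      ((√(1 + k ^ 2))⁻¹ : ℝ) := by
  have hint : Integrable (fun p : ℝ × ℝ => Complex.exp ((k * (p.1 * p.2) : ℝ) * Complex.I))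
      gaussianPair :=
    (integrable_const (1 : ℝ)).mono' (Continuous.aestronglyMeasurable (by fun_prop))
      (ae_of_all _ fun p => by rw [Complex.norm_exp_ofReal_mul_I])
  rw [gaussianPair, integral_prod _ hint]
  have hinner : ∀ y : ℝ, ∫ y' : ℝ, Complex.exp ((k * (y * y') : ℝ) * Complex.I)
      ∂(gaussianReal 0 1) = (rexp (-(k ^ 2 / 2) * y ^ 2) : ℝ) := by
    intro y
    have h1 := charFun_gaussianReal (μ := 0) (v := 1) (k * y)
    rw [charFun_apply_real] at h1
    rw [Complex.ofReal_exp]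
    convert! h1 using 2
    · ext y'
      push_cast
      ring_nf
    · push_cast
      ring
  simp only [hinner]
  rw [integral_complex_ofReal, integral_gaussianReal_eq_integral_smul one_ne_zero]
  congr 1
  have h2 : ∀ x : ℝ, gaussianPDFReal 0 1 x • rexp (-(k ^ 2 / 2) * x ^ 2) =
      (√(2 * π))⁻¹ * rexp (-((1 + k ^ 2) / 2) * x ^ 2) := by
    intro x
    rw [gaussianPDFReal_def, smul_eq_mul]
    simp only [NNReal.coe_one, mul_one, sub_zero]
    rw [mul_assoc, ← Real.exp_add]
    ring_nf
  simp only [h2]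
  rw [integral_const_mul, integral_gaussian, ← Real.sqrt_inv, ← Real.sqrt_inv, ← Real.sqrt_mul
    (by positivity)]
  congr 1
  field_simp

theorem sqrt_eq_integral_gaussianPair {m : ℝ} (hm : 0 < m) (k : ℝ) :
    ((√(k ^ 2 + m ^ 2) : ℝ) : ℂ) = (m : ℂ)⁻¹ *
      ∫ p, Complex.exp ((k * (p.1 * p.2 / m) : ℝ) * Complex.I) * ((k ^ 2 + m ^ 2 : ℝ) : ℂ)
        ∂gaussianPair := by
  rw [integral_mul_const]
  have h1 := integral_cexp_gaussianPair (k / m)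
  have h2 : (fun p : ℝ × ℝ => Complex.exp ((k * (p.1 * p.2 / m) : ℝ) * Complex.I)) =
      fun p => Complex.exp ((k / m * (p.1 * p.2) : ℝ) * Complex.I) := by
    ext p; congr 3; ring
  have h3 : √(1 + (k / m) ^ 2) = √(k ^ 2 + m ^ 2) / m := by
    rw [← Real.sqrt_sq hm.le, ← Real.sqrt_div' _ (by positivity), Real.sqrt_sq hm.le]
    congr 1
    field_simp
    ring
  rw [h2, h1, h3, ← Complex.ofReal_mul, ← Complex.ofReal_inv, ← Complex.ofReal_mul]
  congr 1
  have hs : √(k ^ 2 + m ^ 2) ≠ 0 := (Real.sqrt_pos.2 (by positivity)).ne'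
  field_simp
  exact Real.sq_sqrt (by positivity)

theorem integral_sq_gaussianReal : ∫ y, y ^ 2 ∂(gaussianReal 0 1) = 1 := by
  have h1 := variance_of_integral_eq_zero (X := id) (μ := gaussianReal 0 1) aemeasurable_id
    (by simp)
  rw [variance_id_gaussianReal] at h1
  simpa using h1.symm

theorem integrable_sq_gaussianReal : Integrable (fun y : ℝ => y ^ 2) (gaussianReal 0 1) :=
  (memLp_id_gaussianReal (μ := 0) (v := 1) 2).integrable_sq

theorem integrable_sq_gaussianPair (m : ℝ) :
    Integrable (fun p : ℝ × ℝ => (p.1 * p.2 / m) ^ 2) gaussianPair := by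
  have := (integrable_sq_gaussianReal.mul_prod integrable_sq_gaussianReal).const_mul (m ^ 2)⁻¹
  refine this.congr (ae_of_all _ fun p => ?_)
  simp only [div_pow, mul_pow]
  ring

theorem integral_sq_gaussianPair (m : ℝ) :
    ∫ p, (p.1 * p.2 / m) ^ 2 ∂gaussianPair = (m ^ 2)⁻¹ := by
  have h1 : (fun p : ℝ × ℝ => (p.1 * p.2 / m) ^ 2) =
      fun p => (m ^ 2)⁻¹ * (p.1 ^ 2 * p.2 ^ 2) := by
    ext p
    simp only [div_pow, mul_pow]
    ring
  rw [h1, integral_const_mul, gaussianPair,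
    integral_prod_mul (fun y : ℝ => y ^ 2) (fun y : ℝ => y ^ 2), integral_sq_gaussianReal]
  ring

/-! ### Shifted square roots as averages -/

/-- Here q stands for ((p+a)² + m²)φ. Writing the square root as that polynomial times the average
of m⁻¹ e^{i(k+a)Z}, Fubini turns the multiplier into an average of translates of q, weighted by
e^{iaZ}. -/
theorem symbolOp_sqrt_shift {m : ℝ} (hm : 0 < m) (a : ℝ) {φ q : ℝ → ℂ} (hqc : Continuous q)
    (hq : Integrable q) (hqF : Integrable (𝓕 q))
    (hφ : ∀ ξ : ℝ, (((2 * π * ξ + a) ^ 2 + m ^ 2 : ℝ) : ℂ) * 𝓕 φ ξ = 𝓕 q ξ) (x : ℝ) :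
    symbolOp (fun k => √((k + a) ^ 2 + m ^ 2)) φ x = (m : ℂ)⁻¹ *
      ∫ p, Complex.exp ((a * (p.1 * p.2 / m) : ℝ) * Complex.I) * q (x + p.1 * p.2 / m)
        ∂gaussianPair := by
  set E : ℝ → (ℝ × ℝ) → ℂ := fun ξ p =>
    Complex.exp ((a * (p.1 * p.2 / m) : ℝ) * Complex.I) *
      (Complex.exp ((2 * π * (ξ * (x + p.1 * p.2 / m)) : ℝ) * Complex.I) * 𝓕 q ξ) with hE
  have hprod : Integrable (Function.uncurry E) (volume.prod gaussianPair) := by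
    refine (hqF.norm.comp_fst gaussianPair).mono' ?_ (ae_of_all _ fun z => ?_)
    · refine AEStronglyMeasurable.mul (Continuous.aestronglyMeasurable (by fun_prop))
        (AEStronglyMeasurable.mul (Continuous.aestronglyMeasurable (by fun_prop)) ?_)
      exact hqF.1.comp_fst
    · simp only [Function.uncurry, hE, norm_mul, Complex.norm_exp_ofReal_mul_I, one_mul, le_refl]
  have hleft : ∀ ξ : ℝ, 𝐞 (inner ℝ ξ x) •
      (((√((2 * π * ξ + a) ^ 2 + m ^ 2) : ℝ) : ℂ) * 𝓕 φ ξ) =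
      (m : ℂ)⁻¹ * ∫ p, E ξ p ∂gaussianPair := by
    intro ξ
    rw [sqrt_eq_integral_gaussianPair hm, integral_mul_const, Circle.smul_def, smul_eq_mul,
      mul_assoc, mul_assoc, hφ, mul_left_comm, mul_left_comm (𝐞 (inner ℝ ξ x) : ℂ),
      ← integral_mul_const]
    congr 1
    refine integral_congr_ae (ae_of_all _ fun p => ?_)
    simp only [hE, Real.fourierChar_apply, RCLike.inner_apply, conj_trivial]
    rw [← mul_assoc, ← Complex.exp_add]
    symm
    rw [← mul_assoc, ← Complex.exp_add]
    congr 2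
    push_cast
    ring
  have hright : ∀ p : ℝ × ℝ, ∫ ξ, E ξ p =
      Complex.exp ((a * (p.1 * p.2 / m) : ℝ) * Complex.I) * q (x + p.1 * p.2 / m) := by
    intro p
    simp only [hE]
    rw [integral_const_mul]
    congr 1
    have h1 := congrFun (hqc.fourierInv_fourier_eq hq hqF) (x + p.1 * p.2 / m)
    rw [← h1, fourierInv_eq]
    refine integral_congr_ae (ae_of_all _ fun ξ => ?_)
    simp only [Circle.smul_def, smul_eq_mul, Real.fourierChar_apply, RCLike.inner_apply,
      conj_trivial]
    congr 3
    push_cast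
    ring
  rw [symbolOp, fourierInv_eq]
  simp only [hleft, ← hright]
  rw [integral_const_mul, integral_integral_swap hprod]

/-! ### Pointwise bounds for `h` and its derivatives -/

theorem abs_g_sub_le (x y : ℝ) : |g x - g y| ≤ 4 * |x - y| := by
  have h1 := abs_sin_sub_sin_le (2 * x) (2 * y)
  rw [← mul_sub, abs_mul, abs_two] at h1
  calc |g x - g y| = |2 * (x - y) - (sin (2 * x) - sin (2 * y))| := by
        simp only [g]; ring_nf
    _ ≤ |2 * (x - y)| + |sin (2 * x) - sin (2 * y)| := abs_sub _ _
    _ ≤ 4 * |x - y| := by rw [abs_mul, abs_two]; linarith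

/-- With d = g(x+z) - g(x), the difference is h(x) h(x+z) (d² - 2d g(x+z)). Pairing h(x+z) with
g(x+z) uses |g h| ≤ ½ and leaves h(x) outside, so the bound is relative. -/
theorem abs_h_add_sub_le (x z : ℝ) : |h (x + z) - h x| ≤ h x * (4 * |z| + 16 * z ^ 2) := by
  set d := g (x + z) - g x with hd
  have hd4 : |d| ≤ 4 * |z| := by simpa using abs_g_sub_le (x + z) x
  have h1 : h (x + z) - h x = -(h x * (d * (2 * (g (x + z) * h (x + z))) - d ^ 2 * h (x + z))) := by
    have e1 := h_mul_one_add_sq x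
    have e2 := h_mul_one_add_sq (x + z)
    have e3 : g x = g (x + z) - d := by rw [hd]; ring
    rw [e3] at e1
    linear_combination (h (x + z)) * (-e1) + (h x) * e2
  rw [h1, abs_neg, abs_mul, abs_of_pos (h_pos x)]
  refine mul_le_mul_of_nonneg_left ?_ (h_pos x).le
  have h2 := abs_g_mul_h_le (x + z)
  calc |d * (2 * (g (x + z) * h (x + z))) - d ^ 2 * h (x + z)|
      ≤ |d * (2 * (g (x + z) * h (x + z)))| + |d ^ 2 * h (x + z)| := abs_sub _ _
    _ = |d| * (2 * |g (x + z) * h (x + z)|) + |d| ^ 2 * h (x + z) := by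
        rw [abs_mul, abs_mul, abs_mul (d ^ 2), abs_two, abs_pow, abs_of_pos (h_pos (x + z))]
    _ ≤ |d| * (2 * (1 / 2)) + |d| ^ 2 * 1 := by
        gcongr
        exact h_le_one _
    _ ≤ 4 * |z| + (4 * |z|) ^ 2 := by
        have := abs_nonneg d
        nlinarith
    _ = 4 * |z| + 16 * z ^ 2 := by rw [mul_pow, sq_abs]; norm_num

theorem deriv_h (x : ℝ) : deriv h x = h x * (-2 * (g x * h x) * (2 - 2 * cos (2 * x))) :=
  (hasDerivAt_h x).deriv

theorem differentiable_h : Differentiable ℝ h := fun x => (hasDerivAt_h x).differentiableAt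

theorem differentiable_deriv_h : Differentiable ℝ (deriv h) := by
  have := contDiff_h.differentiable_iteratedDeriv 1 (by exact_mod_cast ENat.natCast_lt_top 1)
  rwa [iteratedDeriv_one] at this

theorem iteratedDeriv_two_h : iteratedDeriv 2 h = deriv (deriv h) := by
  rw [iteratedDeriv_succ, iteratedDeriv_one]

theorem abs_two_sub_le (x : ℝ) : |2 - 2 * cos (2 * x)| ≤ 4 := by
  rw [abs_le]
  constructor <;> linarith [neg_one_le_cos (2 * x), cos_le_one (2 * x)]

theorem abs_deriv_h_le (x : ℝ) : |deriv h x| ≤ 4 * h x := by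
  rw [deriv_h, abs_mul, abs_of_pos (h_pos x), mul_comm]
  refine mul_le_mul_of_nonneg_right ?_ (h_pos x).le
  rw [abs_mul, abs_mul, abs_neg, abs_two]
  have h1 := abs_g_mul_h_le x
  have h2 := abs_two_sub_le x
  calc 2 * |g x * h x| * |2 - 2 * cos (2 * x)| ≤ 2 * (1 / 2) * 4 := by gcongr
    _ = 4 := by norm_num

theorem abs_deriv_deriv_h_le (x : ℝ) : |deriv (deriv h) x| ≤ 52 * h x := by
  set c := 2 - 2 * cos (2 * x) with hc
  set s := sin (2 * x)
  have hcd : HasDerivAt (fun x => 2 - 2 * cos (2 * x)) (4 * s) x := by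
    have h1 : HasDerivAt (fun x : ℝ => 2 * x) 2 x := by simpa using (hasDerivAt_id x).const_mul 2
    convert! (((Real.hasDerivAt_cos (2 * x)).comp x h1).const_mul 2).const_sub 2 using 1
    ring
  have hgh : HasDerivAt (fun x => g x * h x) (c * (h x * (2 * h x - 1))) x := by
    convert! (hasDerivAt_g x).mul (hasDerivAt_h x) using 1
    have := h_mul_one_add_sq x
    rw [← hc]
    linear_combination (2 * c * h x) * this
  have hd : deriv (deriv h) x = h x * ((-2 * (g x * h x) * c) ^ 2 +
      (-2 * (c * (h x * (2 * h x - 1))) * c + -2 * (g x * h x) * (4 * s))) := by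
    rw [funext deriv_h]
    refine ((hasDerivAt_h x).mul ((hgh.const_mul (-2)).mul hcd)).deriv.trans ?_
    simp only [Pi.mul_apply, ← hc]
    ring
  have b1 : |g x * h x| ≤ 1 / 2 := abs_g_mul_h_le x
  have b2 : |c| ≤ 4 := abs_two_sub_le x
  have b3 : |s| ≤ 1 := abs_sin_le_one _
  have b4 : |h x * (2 * h x - 1)| ≤ 1 := by
    have := h_pos x
    have := h_le_one x
    rw [abs_le]
    constructor <;> nlinarith
  rw [hd, abs_mul, abs_of_pos (h_pos x), mul_comm]
  refine mul_le_mul_of_nonneg_right ?_ (h_pos x).le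
  calc |(-2 * (g x * h x) * c) ^ 2 +
        (-2 * (c * (h x * (2 * h x - 1))) * c + -2 * (g x * h x) * (4 * s))|
      ≤ |(-2 * (g x * h x) * c) ^ 2| +
        (|-2 * (c * (h x * (2 * h x - 1))) * c| + |-2 * (g x * h x) * (4 * s)|) :=
        (abs_add_le _ _).trans (add_le_add_right (abs_add_le _ _) _)
    _ = (2 * |g x * h x| * |c|) ^ 2 + (2 * (|c| * |h x * (2 * h x - 1)|) * |c| +
          2 * |g x * h x| * (4 * |s|)) := by
        simp only [abs_pow, abs_mul, abs_neg, Nat.abs_ofNat]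
    _ ≤ (2 * (1 / 2) * 4) ^ 2 + (2 * (4 * 1) * 4 + 2 * (1 / 2) * (4 * 1)) := by gcongr
    _ = 52 := by norm_num

/-! ### Positivity and decay of `f` -/

/-- The integrand in the averaged formula for `f`. -/
noncomputable def avgKernel (m x z : ℝ) : ℝ :=
  2 * (cos z * ((1 + m ^ 2) * h (x + z) - deriv (deriv h) (x + z)) + 2 * sin z * deriv h (x + z))

/-- The relative deviation of `h` is bounded by a quadratic function without linear term. -/
theorem abs_h_add_sub_le_quadratic {m : ℝ} (hm : 0 < m) (x z : ℝ) :
    |h (x + z) - h x| ≤ h x * (2 / m + (2 * m + 16) * z ^ 2) := by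
  refine (abs_h_add_sub_le x z).trans (mul_le_mul_of_nonneg_left ?_ (h_pos x).le)
  -- This weight in 4|z| ≤ 2/m + 2m z² balances the two terms on average, since E Z² = 1/m².
  have h1 : 0 ≤ 2 / m * (m * |z| - 1) ^ 2 := by positivity
  have h2 : 2 / m * (m * |z| - 1) ^ 2 = 2 * m * z ^ 2 - 4 * |z| + 2 / m := by
    rw [← sq_abs z]
    field_simp
    ring
  linarith

theorem abs_remainder_le (x z : ℝ) :
    |-(cos z * deriv (deriv h) (x + z)) + 2 * sin z * deriv h (x + z)| ≤ 60 * h (x + z) := by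
  refine (abs_add_le _ _).trans ?_
  rw [abs_neg, abs_mul, abs_mul, abs_mul, abs_two]
  have h1 := abs_deriv_h_le (x + z)
  have h2 := abs_deriv_deriv_h_le (x + z)
  have h3 := mul_le_of_le_one_left (abs_nonneg (deriv (deriv h) (x + z))) (abs_cos_le_one z)
  have h4 := mul_le_of_le_one_left (abs_nonneg (deriv h (x + z))) (abs_sin_le_one z)
  linarith

theorem abs_avgKernel_le {m : ℝ} (hm : 0 < m) (x z : ℝ) :
    |avgKernel m x z| ≤ 2 * (m ^ 2 + 61) * h x * (1 + 2 / m + (2 * m + 16) * z ^ 2) := by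
  have h1 := abs_remainder_le x z
  have h2 := (abs_le.1 (abs_h_add_sub_le_quadratic hm x z)).2
  have h3 : |cos z * ((1 + m ^ 2) * h (x + z))| ≤ (1 + m ^ 2) * h (x + z) := by
    have hp : 0 ≤ (1 + m ^ 2) * h (x + z) := mul_nonneg (by positivity) (h_pos _).le
    rw [abs_mul, abs_of_nonneg hp]
    exact mul_le_of_le_one_left hp (abs_cos_le_one z)
  calc |avgKernel m x z| = 2 * |cos z * ((1 + m ^ 2) * h (x + z)) +
        (-(cos z * deriv (deriv h) (x + z)) + 2 * sin z * deriv h (x + z))| := by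
        rw [avgKernel, abs_mul, abs_two]; ring_nf
    _ ≤ 2 * ((1 + m ^ 2) * h (x + z) + 60 * h (x + z)) := by
        gcongr
        exact (abs_add_le _ _).trans (add_le_add h3 h1)
    _ = 2 * (m ^ 2 + 61) * h (x + z) := by ring
    _ ≤ 2 * (m ^ 2 + 61) * (h x * (1 + 2 / m + (2 * m + 16) * z ^ 2)) := by
        gcongr
        linarith
    _ = _ := by ring

/-- The main term is (1+m²) cos z · h(x+z). The 17 is the 16 of the quadratic bound plus an
allowance for cos z ≥ 1 - z²/2; the 60 is 52 + 2·4, from the bounds on h'' and h'. -/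
theorem avgKernel_ge {m : ℝ} (hm : 0 < m) (x z : ℝ) :
    2 * h x * ((1 + m ^ 2) * (1 - 2 / m - (2 * m + 17) * z ^ 2) -
      60 * (1 + 2 / m + (2 * m + 16) * z ^ 2)) ≤ avgKernel m x z := by
  have h1 := (abs_le.1 (abs_remainder_le x z)).1
  have hq := abs_h_add_sub_le_quadratic hm x z
  have h2 := (abs_le.1 hq).2
  have h3 : h x * (1 - 2 / m - (2 * m + 17) * z ^ 2) ≤ cos z * h (x + z) := by
    have e : cos z * h (x + z) = h x + (cos z - 1) * h x + cos z * (h (x + z) - h x) := by ring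
    have e1 : -(z ^ 2 / 2) * h x ≤ (cos z - 1) * h x :=
      mul_le_mul_of_nonneg_right (by linarith [one_sub_sq_div_two_le_cos (x := z)]) (h_pos x).le
    have e2 : -(h x * (2 / m + (2 * m + 16) * z ^ 2)) ≤ cos z * (h (x + z) - h x) := by
      refine (abs_le.1 ?_).1
      rw [abs_mul]
      exact (mul_le_of_le_one_left (abs_nonneg _) (abs_cos_le_one z)).trans hq
    have e3 : 0 ≤ h x * z ^ 2 := mul_nonneg (h_pos x).le (sq_nonneg z)
    rw [e]
    nlinarith
  have h4 := mul_le_mul_of_nonneg_left h3 (by positivity : 0 ≤ 1 + m ^ 2)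
  rw [avgKernel]
  linarith

theorem continuous_avgKernel (m : ℝ) : Continuous fun q : ℝ × ℝ => avgKernel m q.1 q.2 := by
  have h1 : Continuous (deriv h) := differentiable_deriv_h.continuous
  have h2 : Continuous (deriv (deriv h)) := by
    rw [← iteratedDeriv_two_h]
    exact continuous_iteratedDeriv_h 2
  have h0 := continuous_h
  unfold avgKernel
  fun_prop

theorem integrable_quadratic_gaussianPair (m a b : ℝ) :
    Integrable (fun p : ℝ × ℝ => a + b * (p.1 * p.2 / m) ^ 2) gaussianPair :=
  (integrable_const a).add ((integrable_sq_gaussianPair m).const_mul b)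

theorem integral_quadratic_gaussianPair (m a b : ℝ) :
    ∫ p, (a + b * (p.1 * p.2 / m) ^ 2) ∂gaussianPair = a + b * (m ^ 2)⁻¹ := by
  rw [integral_add (integrable_const a) ((integrable_sq_gaussianPair m).const_mul b),
    integral_const_mul, integral_sq_gaussianPair]
  simp

theorem integrable_avgKernel {m : ℝ} (hm : 0 < m) (x : ℝ) :
    Integrable (fun p : ℝ × ℝ => avgKernel m x (p.1 * p.2 / m)) gaussianPair := by
  refine ((integrable_quadratic_gaussianPair m (1 + 2 / m) (2 * m + 16)).const_mul
    (2 * (m ^ 2 + 61) * h x)).mono' ?_ (ae_of_all _ fun p => abs_avgKernel_le hm x _)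
  exact ((continuous_avgKernel m).comp (by fun_prop :
    Continuous fun p : ℝ × ℝ => (x, p.1 * p.2 / m))).aestronglyMeasurable

/-- The average of `avgKernel`: the real-valued version of `f`. -/
noncomputable def fReal (m x : ℝ) : ℝ :=
  m⁻¹ * ∫ p, avgKernel m x (p.1 * p.2 / m) ∂gaussianPair

theorem fReal_pos {m : ℝ} (hm : 146 ≤ m) (x : ℝ) : 0 < fReal m x := by
  have hm0 : 0 < m := by linarith
  refine mul_pos (inv_pos.2 hm0) ?_
  set A := (1 + m ^ 2) * (1 - 2 / m) - 60 * (1 + 2 / m) with hA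
  set B := -((1 + m ^ 2) * (2 * m + 17) + 60 * (2 * m + 16)) with hB
  have h1 : ∫ p, 2 * h x * (A + B * (p.1 * p.2 / m) ^ 2) ∂gaussianPair ≤
      ∫ p, avgKernel m x (p.1 * p.2 / m) ∂gaussianPair := by
    refine integral_mono ((integrable_quadratic_gaussianPair m A B).const_mul _)
      (integrable_avgKernel hm0 x) fun p => ?_
    refine le_trans (le_of_eq ?_) (avgKernel_ge hm0 x _)
    simp only [hA, hB]
    ring
  refine lt_of_lt_of_le ?_ h1
  rw [integral_const_mul, integral_quadratic_gaussianPair]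
  refine mul_pos (mul_pos two_pos (h_pos x)) ?_
  have h2 : A + B * (m ^ 2)⁻¹ =
      (m ^ 4 - 4 * m ^ 3 - 76 * m ^ 2 - 244 * m - 977) / m ^ 2 := by
    simp only [hA, hB]
    field_simp
    ring
  rw [h2]
  refine div_pos ?_ (by positivity)
  -- Expanded around 146, the quartic has only positive coefficients.
  obtain ⟨t, ht, rfl⟩ : ∃ t, 0 ≤ t ∧ m = t + 146 := ⟨m - 146, by linarith, by ring⟩
  ring_nf
  positivity

theorem exists_abs_fReal_le {m : ℝ} (hm : 0 < m) : ∃ C, ∀ x, |fReal m x| ≤ C * h x := by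
  refine ⟨m⁻¹ * (2 * (m ^ 2 + 61) * (1 + 2 / m + (2 * m + 16) * (m ^ 2)⁻¹)), fun x => ?_⟩
  rw [fReal, abs_mul, abs_of_pos (inv_pos.2 hm), mul_assoc]
  refine mul_le_mul_of_nonneg_left ?_ (inv_pos.2 hm).le
  calc |∫ p, avgKernel m x (p.1 * p.2 / m) ∂gaussianPair|
      ≤ ∫ p, |avgKernel m x (p.1 * p.2 / m)| ∂gaussianPair := abs_integral_le_integral_abs
    _ ≤ ∫ p, 2 * (m ^ 2 + 61) * h x * (1 + 2 / m + (2 * m + 16) * (p.1 * p.2 / m) ^ 2)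
          ∂gaussianPair :=
        integral_mono (integrable_avgKernel hm x).abs
          ((integrable_quadratic_gaussianPair m _ _).const_mul _) fun p => abs_avgKernel_le hm x _
    _ = _ := by
        rw [integral_const_mul, integral_quadratic_gaussianPair]
        ring

/-! ### The formula for `f` -/

/-- `𝓕 h`. -/
noncomputable def hHat : ℝ → ℂ := 𝓕 fun x => (h x : ℂ)

theorem integrable_deriv_h : Integrable (deriv h) := by
  simpa using integrable_iteratedDeriv_h 1

theorem integrable_deriv_deriv_h : Integrable (deriv (deriv h)) := by
  simpa [iteratedDeriv_two_h] using integrable_iteratedDeriv_h 2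

theorem fourier_ofReal_deriv {k : ℝ → ℝ} (hk : Integrable k) (hd : Differentiable ℝ k)
    (hk' : Integrable (deriv k)) (ξ : ℝ) :
    𝓕 (fun x => ((deriv k x : ℝ) : ℂ)) ξ = 2 * π * Complex.I * ξ * 𝓕 (fun x => (k x : ℂ)) ξ := by
  have h1 : deriv (fun x => (k x : ℂ)) = fun x => ((deriv k x : ℝ) : ℂ) :=
    funext fun x => ((hd x).hasDerivAt.ofReal_comp).deriv
  have h2 := congrFun (fourier_deriv hk.ofReal
    (fun x => ((hd x).hasDerivAt.ofReal_comp).differentiableAt) (h1 ▸ hk'.ofReal)) ξ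
  rw [h1] at h2
  exact h2

/-- `((p + a)² + m²) h`. -/
noncomputable def shiftedOp (m a x : ℝ) : ℂ :=
  ((a ^ 2 + m ^ 2) * h x - deriv (deriv h) x : ℝ) - 2 * a * Complex.I * (deriv h x : ℝ)

theorem continuous_shiftedOp (m a : ℝ) : Continuous (shiftedOp m a) := by
  have h1 : Continuous (deriv h) := differentiable_deriv_h.continuous
  have h2 : Continuous (deriv (deriv h)) := by
    rw [← iteratedDeriv_two_h]
    exact continuous_iteratedDeriv_h 2
  have h0 := continuous_h
  unfold shiftedOp
  fun_prop

theorem integrable_shiftedOp (m a : ℝ) : Integrable (shiftedOp m a) :=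
  ((integrable_h.const_mul _).sub integrable_deriv_deriv_h).ofReal.sub
    (integrable_deriv_h.ofReal.const_mul _)

theorem fourier_shiftedOp (m a ξ : ℝ) :
    𝓕 (shiftedOp m a) ξ = (((2 * π * ξ + a) ^ 2 + m ^ 2 : ℝ) : ℂ) * hHat ξ := by
  have i0 : Integrable fun x => ((h x : ℝ) : ℂ) := integrable_h.ofReal
  have i1 : Integrable fun x => ((deriv h x : ℝ) : ℂ) := integrable_deriv_h.ofReal
  have i2 : Integrable fun x => ((deriv (deriv h) x : ℝ) : ℂ) := integrable_deriv_deriv_h.ofReal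
  have e1 := fourier_ofReal_deriv integrable_h differentiable_h integrable_deriv_h ξ
  have e2 := fourier_ofReal_deriv integrable_deriv_h differentiable_deriv_h
    integrable_deriv_deriv_h ξ
  have c : ∀ {k : ℝ → ℂ}, Integrable k → Integrable fun x => 𝐞 (-inner ℝ x ξ) • k x :=
    fun hk => (Real.fourierIntegral_convergent_iff ξ).2 hk
  have hlin : 𝓕 (shiftedOp m a) ξ = (a ^ 2 + m ^ 2) * hHat ξ -
      𝓕 (fun x => ((deriv (deriv h) x : ℝ) : ℂ)) ξ -
      2 * a * Complex.I * 𝓕 (fun x => ((deriv h x : ℝ) : ℂ)) ξ := by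
    simp only [hHat, fourier_eq]
    rw [← integral_const_mul, ← integral_const_mul, ← integral_sub ((c i0).const_mul _) (c i2),
      ← integral_sub (by exact ((c i0).const_mul _).sub (c i2)) ((c i1).const_mul _)]
    refine integral_congr_ae (ae_of_all _ fun x => ?_)
    simp only [shiftedOp, Circle.smul_def, smul_eq_mul]
    push_cast
    ring
  rw [hlin, e2, e1, ← hHat]
  push_cast
  linear_combination (-4 * π ^ 2 * ξ ^ 2 * hHat ξ - 4 * a * π * ξ * hHat ξ) * Complex.I_sq

theorem rapidDecay_poly (m a : ℝ) :
    RapidDecay fun ξ : ℝ => (((2 * π * ξ + a) ^ 2 + m ^ 2 : ℝ) : ℂ) * hHat ξ := by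
  refine rapidDecay_fourier_h.mul (by fun_prop)
    (K := 8 * π ^ 2 + 2 * a ^ 2 + m ^ 2) (k := 1) fun ξ => ?_
  rw [Complex.norm_real, Real.norm_eq_abs, abs_of_nonneg (by positivity), pow_one]
  nlinarith [sq_nonneg (2 * π * ξ - a), mul_nonneg (sq_nonneg a) (sq_nonneg ξ),
    mul_nonneg (sq_nonneg m) (sq_nonneg ξ), sq_nonneg π]

theorem symbolOp_sqrt_shift_h {m : ℝ} (hm : 0 < m) (a x : ℝ) :
    symbolOp (fun k => √((k + a) ^ 2 + m ^ 2)) (fun x => (h x : ℂ)) x = (m : ℂ)⁻¹ *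
      ∫ p, Complex.exp ((a * (p.1 * p.2 / m) : ℝ) * Complex.I) *
        shiftedOp m a (x + p.1 * p.2 / m) ∂gaussianPair := by
  refine symbolOp_sqrt_shift hm a (continuous_shiftedOp m a) (integrable_shiftedOp m a) ?_
    (fun ξ => (fourier_shiftedOp m a ξ).symm) x
  rw [funext (fourier_shiftedOp m a)]
  exact (rapidDecay_poly m a).integrable

theorem exists_norm_shiftedOp_le (m a : ℝ) : ∃ C, ∀ x, ‖shiftedOp m a x‖ ≤ C := by
  refine ⟨(a ^ 2 + m ^ 2) + 52 + 2 * |a| * 4, fun x => ?_⟩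
  have h1 := abs_deriv_h_le x
  have h2 := abs_deriv_deriv_h_le x
  have h3 := h_le_one x
  have h4 := h_pos x
  refine (norm_sub_le _ _).trans (add_le_add ?_ ?_)
  · rw [Complex.norm_real, Real.norm_eq_abs]
    refine (abs_sub _ _).trans (add_le_add ?_ (by linarith))
    rw [abs_of_nonneg (by positivity)]
    exact mul_le_of_le_one_right (by positivity) h3
  · simp only [norm_mul, Complex.norm_I, Complex.norm_real, Real.norm_eq_abs, mul_one,
      Complex.norm_ofNat]
    gcongr
    linarith

theorem integrable_exp_mul_shiftedOp (m a x : ℝ) :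
    Integrable (fun p : ℝ × ℝ => Complex.exp ((a * (p.1 * p.2 / m) : ℝ) * Complex.I) *
        shiftedOp m a (x + p.1 * p.2 / m)) gaussianPair := by
  obtain ⟨C, hC⟩ := exists_norm_shiftedOp_le m a
  refine (integrable_const C).mono' ?_ (ae_of_all _ fun p => ?_)
  · have := continuous_shiftedOp m a
    exact Continuous.aestronglyMeasurable (by fun_prop)
  · rw [norm_mul, Complex.norm_exp_ofReal_mul_I, one_mul]
    exact hC _

theorem rapidDecay_sqrt_mul {φ : ℝ → ℂ} (hφ : RapidDecay φ) (m a : ℝ) :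
    RapidDecay fun ξ : ℝ => ((√((2 * π * ξ + a) ^ 2 + m ^ 2) : ℝ) : ℂ) * φ ξ := by
  refine hφ.mul (by fun_prop) (K := 1 + 8 * π ^ 2 + 2 * a ^ 2 + m ^ 2) (k := 1) fun ξ => ?_
  rw [Complex.norm_real, Real.norm_eq_abs, abs_of_nonneg (Real.sqrt_nonneg _), pow_one]
  have h1 : √((2 * π * ξ + a) ^ 2 + m ^ 2) ≤ 1 + ((2 * π * ξ + a) ^ 2 + m ^ 2) := by
    rw [Real.sqrt_le_left (by positivity)]
    nlinarith [sq_nonneg ((2 * π * ξ + a) ^ 2 + m ^ 2), sq_nonneg (2 * π * ξ + a), sq_nonneg m]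
  refine h1.trans ?_
  nlinarith [sq_nonneg (2 * π * ξ - a), mul_nonneg (sq_nonneg a) (sq_nonneg ξ),
    mul_nonneg (sq_nonneg m) (sq_nonneg ξ), sq_nonneg π]

/-- The shifts a = 1 and a = -1 contribute complex conjugate integrands, whose sum is the real
`avgKernel`. -/
theorem f_eq_fReal {m : ℝ} (hm : 0 < m) (x : ℝ) : f m x = (fReal m x : ℝ) := by
  have hc : ∀ {k : ℝ → ℂ}, Integrable k → Integrable fun ξ => 𝐞 (inner ℝ ξ x) • k ξ := by
    intro k hk
    simpa using (Real.fourierIntegral_convergent_iff (-x)).2 hk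
  have h1 : f m x = symbolOp (fun k => √((k + 1) ^ 2 + m ^ 2)) (fun x => (h x : ℂ)) x +
      symbolOp (fun k => √((k + (-1)) ^ 2 + m ^ 2)) (fun x => (h x : ℂ)) x := by
    simp only [f, symbolOp, fourierInv_eq]
    rw [← integral_add (hc (rapidDecay_sqrt_mul rapidDecay_fourier_h m 1).integrable)
      (hc (rapidDecay_sqrt_mul rapidDecay_fourier_h m (-1)).integrable)]
    refine integral_congr_ae (ae_of_all _ fun ξ => ?_)
    simp only [← smul_add, ← add_mul, ← Complex.ofReal_add, sub_eq_add_neg]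
  rw [h1, symbolOp_sqrt_shift_h hm, symbolOp_sqrt_shift_h hm, ← mul_add,
    ← integral_add (integrable_exp_mul_shiftedOp m 1 x) (integrable_exp_mul_shiftedOp m (-1) x),
    fReal, Complex.ofReal_mul, Complex.ofReal_inv, ← integral_complex_ofReal]
  congr 1
  refine integral_congr_ae (ae_of_all _ fun p => ?_)
  simp only [shiftedOp, avgKernel]
  set z := p.1 * p.2 / m
  rw [one_mul, neg_one_mul, Complex.exp_mul_I, Complex.exp_mul_I, ← Complex.ofReal_cos,
    ← Complex.ofReal_sin, ← Complex.ofReal_cos, ← Complex.ofReal_sin, cos_neg, sin_neg]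
  push_cast
  linear_combination (-4 * Complex.sin z * (deriv h (x + z) : ℝ)) * Complex.I_sq

/-! ### Elementary rules for the inverse Fourier integral on the line -/

theorem integrable_fourierChar_smul {φ : ℝ → ℂ} (hφ : Integrable φ) (x : ℝ) :
    Integrable fun ξ => 𝐞 (inner ℝ ξ x) • φ ξ := by
  simpa using (Real.fourierIntegral_convergent_iff (-x)).2 hφ

theorem fourierInv_add {φ ψ : ℝ → ℂ} (hφ : Integrable φ) (hψ : Integrable ψ) (x : ℝ) :
    𝓕⁻ (fun ξ => φ ξ + ψ ξ) x = 𝓕⁻ φ x + 𝓕⁻ ψ x := by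
  simp only [fourierInv_eq, smul_add]
  exact integral_add (integrable_fourierChar_smul hφ x) (integrable_fourierChar_smul hψ x)

theorem fourierInv_const_mul (c : ℂ) (φ : ℝ → ℂ) (x : ℝ) :
    𝓕⁻ (fun ξ => c * φ ξ) x = c * 𝓕⁻ φ x := by
  simp only [fourierInv_eq, Circle.smul_def, smul_eq_mul, mul_left_comm _ c, integral_const_mul]

theorem fourierInv_comp_add (φ : ℝ → ℂ) (a x : ℝ) :
    𝓕⁻ (fun ξ => φ (ξ + a)) x = 𝐞 (-(a * x)) * 𝓕⁻ φ x := by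
  simp only [fourierInv_eq]
  rw [← integral_add_right_eq_self (fun ξ => 𝐞 (inner ℝ ξ x) • φ ξ) a, ← integral_const_mul]
  refine integral_congr_ae (ae_of_all _ fun ξ => ?_)
  simp only [Circle.smul_def, smul_eq_mul, ← mul_assoc, ← Circle.coe_mul, ← AddChar.map_add_eq_mul,
    RCLike.inner_apply, conj_trivial]
  congr 3
  ring

theorem continuous_fourierInv {φ : ℝ → ℂ} (hφ : Integrable φ) : Continuous (𝓕⁻ φ) := by
  have : 𝓕⁻ φ = fun x => 𝓕 φ (-x) := funext fun x => fourierInv_eq_fourier_neg φ x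
  rw [this]
  exact (VectorFourier.fourierIntegral_continuous Real.continuous_fourierChar
    (by exact continuous_inner) hφ).comp continuous_neg

theorem conj_fourierInv {φ : ℝ → ℂ} (hφ : ∀ ξ, starRingEnd ℂ (φ ξ) = φ (-ξ)) (x : ℝ) :
    starRingEnd ℂ (𝓕⁻ φ x) = 𝓕⁻ φ x := by
  rw [fourierInv_eq, ← integral_conj, ← integral_neg_eq_self]
  refine integral_congr_ae (ae_of_all _ fun ξ => ?_)
  simp only [Circle.smul_def, smul_eq_mul, map_mul, hφ, neg_neg, ← Circle.coe_inv_eq_conj,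
    ← AddChar.map_neg_eq_inv, inner_neg_left]

theorem conj_hHat (ξ : ℝ) : starRingEnd ℂ (hHat ξ) = hHat (-ξ) := by
  rw [hHat, fourier_eq, fourier_eq, ← integral_conj]
  refine integral_congr_ae (ae_of_all _ fun x => ?_)
  simp only [Circle.smul_def, smul_eq_mul, map_mul, Complex.conj_ofReal,
    ← Circle.coe_inv_eq_conj, ← AddChar.map_neg_eq_inv, inner_neg_right]

theorem hHat_neg (ξ : ℝ) : hHat (-ξ) = hHat ξ := by
  have h1 : ∀ x, h (-x) = h x := fun x => by simp [h, g_odd]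
  rw [hHat, ← fourierInv_eq_fourier_neg, fourierInv_eq_fourier_comp_neg]
  simp only [h1]

/-! ### The Fourier transforms of `f` and `u` -/

/-- The symbol `√((k + 1)² + m²) + √((k - 1)² + m²)` at `k = 2πξ`. -/
noncomputable def sumSymbol (m ξ : ℝ) : ℝ :=
  √((2 * π * ξ + 1) ^ 2 + m ^ 2) + √((2 * π * ξ - 1) ^ 2 + m ^ 2)

/-- `𝓕 f`. -/
noncomputable def fHat (m ξ : ℝ) : ℂ := (sumSymbol m ξ : ℂ) * hHat ξ

theorem f_eq_fourierInv (m : ℝ) : f m = 𝓕⁻ (fHat m) := rfl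

theorem sumSymbol_neg (m ξ : ℝ) : sumSymbol m (-ξ) = sumSymbol m ξ := by
  rw [sumSymbol, sumSymbol, add_comm]
  congr 3 <;> ring

theorem fHat_neg (m ξ : ℝ) : fHat m (-ξ) = fHat m ξ := by
  rw [fHat, fHat, sumSymbol_neg, hHat_neg]

theorem rapidDecay_sumSymbol_mul {φ : ℝ → ℂ} (hφ : RapidDecay φ) (m : ℝ) :
    RapidDecay fun ξ => (sumSymbol m ξ : ℂ) * φ ξ := by
  have h1 := (rapidDecay_sqrt_mul hφ m 1).add (rapidDecay_sqrt_mul hφ m (-1))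
  simpa only [sumSymbol, Complex.ofReal_add, add_mul, ← sub_eq_add_neg] using h1

theorem rapidDecay_fHat (m : ℝ) : RapidDecay (fHat m) :=
  rapidDecay_sumSymbol_mul rapidDecay_fourier_h m

theorem continuous_f (m : ℝ) : Continuous (f m) :=
  continuous_fourierInv (rapidDecay_fHat m).integrable

theorem integrable_f {m : ℝ} (hm : 0 < m) : Integrable (f m) := by
  obtain ⟨C, hC⟩ := exists_abs_fReal_le hm
  refine (integrable_h.const_mul C).mono' (continuous_f m).aestronglyMeasurable
    (ae_of_all _ fun x => ?_)
  rw [f_eq_fReal hm, Complex.norm_real]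
  exact hC x

/-- Inversion needs f itself to be integrable; this comes from the bound by C h in the averaged
formula. -/
theorem fourier_f {m : ℝ} (hm : 0 < m) : 𝓕 (f m) = fHat m := by
  rw [f_eq_fourierInv]
  refine (rapidDecay_fHat m).continuous.fourier_fourierInv_eq (rapidDecay_fHat m).integrable ?_
  have h1 : 𝓕 (fHat m) = fun x => f m (-x) := by
    ext x
    rw [f_eq_fourierInv, fourierInv_eq_fourier_neg, neg_neg]
  rw [h1]
  exact (integrable_f hm).comp_neg

theorem continuous_u (m : ℝ) : Continuous (u m) := by
  have := continuous_f m
  unfold u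
  fun_prop

theorem integrable_u {m : ℝ} (hm : 0 < m) : Integrable (u m) := by
  refine (integrable_f hm).norm.mono' (continuous_u m).aestronglyMeasurable
    (ae_of_all _ fun x => ?_)
  rw [u, norm_mul, Complex.norm_real]
  exact mul_le_of_le_one_right (norm_nonneg _) (abs_sin_le_one x)

/-- `𝓕 u`. -/
noncomputable def uHat (m ξ : ℝ) : ℂ :=
  (2 * Complex.I)⁻¹ * (fHat m (ξ + -(2 * π)⁻¹) - fHat m (ξ + (2 * π)⁻¹))

theorem rapidDecay_uHat (m : ℝ) : RapidDecay (uHat m) :=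
  (((rapidDecay_fHat m).comp_add _).sub ((rapidDecay_fHat m).comp_add _)).const_mul _

theorem uHat_neg (m ξ : ℝ) : uHat m (-ξ) = -uHat m ξ := by
  rw [uHat, uHat, ← fHat_neg m (-ξ + -(2 * π)⁻¹), ← fHat_neg m (-ξ + (2 * π)⁻¹)]
  simp only [neg_add, neg_neg]
  ring

theorem fourierChar_two_pi_inv_mul (x : ℝ) :
    (𝐞 ((2 * π)⁻¹ * x) : ℂ) = Complex.cos x + Complex.sin x * Complex.I := by
  rw [Real.fourierChar_apply, ← Complex.exp_mul_I]
  congr 2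
  push_cast
  have : (π : ℂ) ≠ 0 := by exact_mod_cast Real.pi_ne_zero
  field_simp

theorem fourierChar_neg_two_pi_inv_mul (x : ℝ) :
    (𝐞 (-((2 * π)⁻¹ * x)) : ℂ) = Complex.cos x - Complex.sin x * Complex.I := by
  rw [← mul_neg, fourierChar_two_pi_inv_mul]
  push_cast
  rw [Complex.cos_neg, Complex.sin_neg]
  ring

theorem fourierInv_uHat (m : ℝ) : 𝓕⁻ (uHat m) = u m := by
  ext x
  have i1 := ((rapidDecay_fHat m).comp_add (-(2 * π)⁻¹)).integrable
  have i2 := ((rapidDecay_fHat m).comp_add ((2 * π)⁻¹)).integrable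
  have h1 : uHat m = fun ξ => (2 * Complex.I)⁻¹ *
      (fHat m (ξ + -(2 * π)⁻¹) + (-1) * fHat m (ξ + (2 * π)⁻¹)) := by
    ext ξ
    rw [uHat]
    ring
  rw [h1, fourierInv_const_mul, fourierInv_add i1 (i2.const_mul _), fourierInv_const_mul,
    fourierInv_comp_add, fourierInv_comp_add, neg_mul, neg_neg, fourierChar_two_pi_inv_mul,
    fourierChar_neg_two_pi_inv_mul, ← f_eq_fourierInv, u, Complex.ofReal_sin]
  field_simp
  ring

theorem fourier_u {m : ℝ} (hm : 0 < m) : 𝓕 (u m) = uHat m := by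
  rw [← fourierInv_uHat]
  refine (rapidDecay_uHat m).continuous.fourier_fourierInv_eq (rapidDecay_uHat m).integrable ?_
  have h1 : 𝓕 (uHat m) = fun x => u m (-x) := by
    ext x
    rw [← fourierInv_uHat, fourierInv_eq_fourier_neg, neg_neg]
  rw [h1]
  exact (integrable_u hm).comp_neg

/-! ### The kinetic energy of `u` -/

/-- The Fourier transform of `(√(p² + m²) - m) u`. -/
noncomputable def kHat (m ξ : ℝ) : ℂ := ((√((2 * π * ξ) ^ 2 + m ^ 2) - m : ℝ) : ℂ) * uHat m ξ

theorem kineticU_eq_fourierInv {m : ℝ} (hm : 0 < m) : kineticU m = 𝓕⁻ (kHat m) := by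
  rw [kineticU, symbolOp, fourier_u hm]
  rfl

theorem rapidDecay_sqrt_sub_mul {φ : ℝ → ℂ} (hφ : RapidDecay φ) (m a : ℝ) :
    RapidDecay fun ξ => ((√((2 * π * ξ + a) ^ 2 + m ^ 2) - m : ℝ) : ℂ) * φ ξ := by
  simpa only [Complex.ofReal_sub, sub_mul] using (rapidDecay_sqrt_mul hφ m a).sub (hφ.const_mul m)

theorem rapidDecay_kHat (m : ℝ) : RapidDecay (kHat m) := by
  simpa only [add_zero] using! rapidDecay_sqrt_sub_mul (rapidDecay_uHat m) m 0

theorem kHat_neg (m ξ : ℝ) : kHat m (-ξ) = -kHat m ξ := by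
  rw [kHat, kHat, uHat_neg, mul_neg, mul_neg, neg_sq]

/-- The Fourier transform of half of `(√((p + 1)² + m²) + √((p - 1)² + m²)) f`. -/
noncomputable def halfSqHat (m ξ : ℝ) : ℂ := ((sumSymbol m ξ / 2 : ℝ) : ℂ) * fHat m ξ

/-- Half of `(√((p + 1)² + m²) + √((p - 1)² + m²)) f`. -/
noncomputable def halfSq (m : ℝ) : ℝ → ℂ := 𝓕⁻ (halfSqHat m)

theorem rapidDecay_halfSqHat (m : ℝ) : RapidDecay (halfSqHat m) := by
  have := (rapidDecay_sumSymbol_mul (rapidDecay_fHat m) m).const_mul (1 / 2)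
  convert! this using 2 with ξ
  rw [halfSqHat]
  push_cast
  ring

theorem continuous_halfSq (m : ℝ) : Continuous (halfSq m) :=
  continuous_fourierInv (rapidDecay_halfSqHat m).integrable

theorem conj_halfSq (m x : ℝ) : starRingEnd ℂ (halfSq m x) = halfSq m x := by
  refine conj_fourierInv (fun ξ => ?_) x
  rw [halfSqHat, halfSqHat, fHat, fHat, sumSymbol_neg]
  simp only [map_mul, Complex.conj_ofReal, conj_hHat]

theorem rapidDecay_fourier_deriv_h : RapidDecay fun ξ => 2 * π * Complex.I * ξ * hHat ξ := by
  refine rapidDecay_fourier_h.mul (by fun_prop) (K := 2 * π) (k := 1) fun ξ => ?_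
  simp only [norm_mul, Complex.norm_I, Complex.norm_real, Real.norm_eq_abs, abs_of_pos pi_pos,
    Complex.norm_ofNat, mul_one, pow_one]
  gcongr
  rw [← sq_abs]
  nlinarith [sq_nonneg (|ξ| - 1), abs_nonneg ξ]

theorem fourierInv_deriv_h (x : ℝ) :
    𝓕⁻ (fun ξ => 2 * π * Complex.I * ξ * hHat ξ) x = (deriv h x : ℝ) := by
  have h1 : 𝓕 (fun x => ((deriv h x : ℝ) : ℂ)) = fun ξ => 2 * π * Complex.I * ξ * hHat ξ :=
    funext (fourier_ofReal_deriv integrable_h differentiable_h integrable_deriv_h)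
  rw [← h1]
  refine congrFun (Continuous.fourierInv_fourier_eq ?_ integrable_deriv_h.ofReal ?_) x
  · exact Complex.continuous_ofReal.comp differentiable_deriv_h.continuous
  · rw [h1]
    exact rapidDecay_fourier_deriv_h.integrable

theorem fourierInv_sqrt_sub_mul_fHat (m x a : ℝ) (ha : a = 1 ∨ a = -1) :
    𝓕⁻ (fun ξ => ((√((2 * π * ξ + a) ^ 2 + m ^ 2) - m : ℝ) : ℂ) * fHat m ξ) x =
      halfSq m x - m * f m x - 2 * a * Complex.I * (deriv h x : ℝ) := by
  have h1 : (fun ξ => ((√((2 * π * ξ + a) ^ 2 + m ^ 2) - m : ℝ) : ℂ) * fHat m ξ) =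
      fun ξ => (halfSqHat m ξ + (-m) * fHat m ξ) +
        (-2 * a * Complex.I) * (2 * π * Complex.I * ξ * hHat ξ) := by
    ext ξ
    have e1 := Real.sq_sqrt (by positivity : 0 ≤ (2 * π * ξ + 1) ^ 2 + m ^ 2)
    have e2 := Real.sq_sqrt (by positivity : 0 ≤ (2 * π * ξ - 1) ^ 2 + m ^ 2)
    -- With k = 2πξ this is A(A+B) = ½(A+B)² + ½(A²-B²) and its counterpart for B, where A² - B² =
    -- 4k. The linear term 2ak, applied to h, becomes -2ai h'.
    have e3 : √((2 * π * ξ + a) ^ 2 + m ^ 2) * sumSymbol m ξ =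
        sumSymbol m ξ / 2 * sumSymbol m ξ + 4 * π * a * ξ := by
      rcases ha with rfl | rfl
      · rw [sumSymbol]
        linear_combination (1 / 2) * e1 - (1 / 2) * e2
      · rw [sumSymbol, ← sub_eq_add_neg]
        linear_combination -(1 / 2) * e1 + (1 / 2) * e2
    have e4 := congrArg (fun t : ℝ => (t : ℂ)) e3
    simp only [Complex.ofReal_mul, Complex.ofReal_add] at e4
    rw [halfSqHat, fHat]
    push_cast at e4 ⊢
    linear_combination hHat ξ * e4 + 4 * π * a * ξ * hHat ξ * Complex.I_sq
  have i1 := (rapidDecay_halfSqHat m).integrable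
  have i2 := (rapidDecay_fHat m).integrable.const_mul (-m : ℂ)
  have i3 := rapidDecay_fourier_deriv_h.integrable.const_mul (-2 * a * Complex.I)
  rw [h1, fourierInv_add (by exact i1.add i2) i3, fourierInv_add i1 i2, fourierInv_const_mul,
    fourierInv_const_mul, fourierInv_deriv_h, ← f_eq_fourierInv, halfSq]
  ring

/-- The numerator of the formula for the potential. -/
noncomputable def potNum (m x : ℝ) : ℂ :=
  halfSq m x + ((16 * sin x * cos x * g x * h x ^ 2 : ℝ) : ℂ)

/-- The two shifts in `uHat` recombine into sin x times the part common to A f and B f, plus -2 cos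
x · h'. The latter equals 16 sin² x cos x · g h², which supplies the missing factor sin x. -/
theorem kineticU_eq {m : ℝ} (hm : 0 < m) (x : ℝ) :
    kineticU m x = (potNum m x - m * f m x) * sin x := by
  set Φ : ℝ → ℝ → ℂ := fun a ξ =>
    ((√((2 * π * ξ + a) ^ 2 + m ^ 2) - m : ℝ) : ℂ) * fHat m ξ with hΦ
  have h1 : kHat m = fun ξ => (2 * Complex.I)⁻¹ *
      (Φ 1 (ξ + -(2 * π)⁻¹) + (-1) * Φ (-1) (ξ + (2 * π)⁻¹)) := by
    ext ξ
    have e1 : 2 * π * (ξ + -(2 * π)⁻¹) + 1 = 2 * π * ξ := by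
      have := Real.pi_ne_zero
      field_simp
      ring
    have e2 : 2 * π * (ξ + (2 * π)⁻¹) + -1 = 2 * π * ξ := by
      have := Real.pi_ne_zero
      field_simp
      ring
    simp only [hΦ, e1, e2, kHat, uHat]
    ring
  have i : ∀ a, RapidDecay (Φ a) := fun a => rapidDecay_sqrt_sub_mul (rapidDecay_fHat m) m a
  have i1 := ((i 1).comp_add (-(2 * π)⁻¹)).integrable
  have i2 := ((i (-1)).comp_add ((2 * π)⁻¹)).integrable
  rw [kineticU_eq_fourierInv hm, h1, fourierInv_const_mul, fourierInv_add i1 (i2.const_mul _),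
    fourierInv_const_mul, fourierInv_comp_add, fourierInv_comp_add, neg_mul, neg_neg,
    fourierChar_two_pi_inv_mul, fourierChar_neg_two_pi_inv_mul,
    fourierInv_sqrt_sub_mul_fHat m x 1 (Or.inl rfl),
    fourierInv_sqrt_sub_mul_fHat m x (-1) (Or.inr rfl), potNum, deriv_h]
  have h2 : 2 - 2 * cos (2 * x) = 4 * sin x ^ 2 := by
    rw [cos_two_mul]
    linear_combination -4 * sin_sq_add_cos_sq x
  rw [h2]
  push_cast
  field_simp
  ring

/-! ### The potential -/

theorem f_ne_zero {m : ℝ} (hm : 146 ≤ m) (x : ℝ) : f m x ≠ 0 := by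
  rw [f_eq_fReal (by linarith)]
  exact_mod_cast (fReal_pos hm x).ne'

theorem u_eq_zero_iff {m : ℝ} (hm : 146 ≤ m) (x : ℝ) : u m x = 0 ↔ sin x = 0 := by
  rw [u, mul_eq_zero, or_iff_right (f_ne_zero hm x), Complex.ofReal_eq_zero]

theorem continuous_potential {m : ℝ} (hm : 146 ≤ m) :
    Continuous fun y => ((eigenval m + m : ℝ) : ℂ) - potNum m y / f m y := by
  have h1 := continuous_halfSq m
  have h2 := continuous_h
  have h3 : Continuous g := by unfold g; fun_prop
  refine continuous_const.sub (Continuous.div ?_ (continuous_f m) (f_ne_zero hm))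
  unfold potNum
  fun_prop

/-- Away from the zeros of u the sine cancels; at a zero the limit is the value of the continuous
right-hand side. -/
theorem V_eq {m : ℝ} (hm : 146 ≤ m) (x : ℝ) :
    V m x = ((eigenval m + m : ℝ) : ℂ) - potNum m x / f m x := by
  have hm0 : 0 < m := by linarith
  have hoff : ∀ y, sin y ≠ 0 → (eigenval m : ℂ) - kineticU m y / u m y =
      ((eigenval m + m : ℝ) : ℂ) - potNum m y / f m y := by
    intro y hy
    have hf := f_ne_zero hm y
    have hy' : (sin y : ℂ) ≠ 0 := by exact_mod_cast hy
    rw [kineticU_eq hm0, u, Complex.ofReal_add]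
    field_simp
    ring
  by_cases hx : u m x = 0
  · rw [V, if_pos hx]
    have hx' := (u_eq_zero_iff hm x).1 hx
    refine Tendsto.limUnder_eq ?_
    refine ((continuous_potential hm).continuousAt.tendsto.mono_left nhdsWithin_le_nhds).congr' ?_
    -- The zeros of sine are simple, so a punctured neighbourhood contains no other zero.
    have hcos : cos x ≠ 0 := by
      intro hc
      have := sin_sq_add_cos_sq x
      rw [hx', hc] at this
      norm_num at this
    filter_upwards [(hasDerivAt_sin x).eventually_ne hcos (c := 0)] with y hy
    exact (hoff y hy).symm
  · rw [V, if_neg hx]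
    exact hoff x fun h0 => hx ((u_eq_zero_iff hm x).2 h0)

theorem continuous_V {m : ℝ} (hm : 146 ≤ m) : Continuous (V m) := by
  rw [funext (V_eq hm)]
  exact continuous_potential hm

/-- The transform defining `halfSq` is Hermitian because h is real and the symbol is real and even.
-/
theorem V_im {m : ℝ} (hm : 146 ≤ m) (x : ℝ) : (V m x).im = 0 := by
  rw [← Complex.conj_eq_iff_im, V_eq hm, f_eq_fReal (by linarith), potNum]
  simp only [map_sub, map_div₀, map_add, Complex.conj_ofReal, conj_halfSq]

theorem V_mul_u {m : ℝ} (hm : 146 ≤ m) (x : ℝ) :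
    V m x * u m x = eigenval m * u m x - kineticU m x := by
  have hf := f_ne_zero hm x
  rw [V_eq hm, kineticU_eq (by linarith), u, Complex.ofReal_add]
  field_simp
  ring

/-! ### From odd functions on the line to radial functions on `ℝ³` -/

/-- The radial function `x ↦ w(|x|) / |x|`. -/
noncomputable def lift (w : ℝ → ℂ) (x : R3) : ℂ := w ‖x‖ / (‖x‖ : ℂ)

theorem integrable_lift {w : ℝ → ℂ} (hw : RapidDecay w) : Integrable (lift w) := by
  refine (integrable_fun_norm_addHaar (volume : Measure R3) (f := fun s => w s / (s : ℂ))).2 ?_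
  obtain ⟨C, -, hC⟩ := hw.norm_le 2
  have hm := hw.continuous.measurable
  refine ((integrable_inv_one_add_sq.const_mul C).integrableOn).mono' (by fun_prop) ?_
  filter_upwards [ae_restrict_mem measurableSet_Ioi] with y (hy : 0 < y)
  have h1 : ‖y ^ (Module.finrank ℝ R3 - 1) • (w y / (y : ℂ))‖ = y * ‖w y‖ := by
    simp [abs_of_pos hy]
    field_simp
  rw [h1]
  calc y * ‖w y‖ ≤ (1 + y ^ 2) * (C * ((1 + y ^ 2) ^ 2)⁻¹) := by
        gcongr
        · nlinarith [sq_nonneg (y - 1)]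
        · exact hC y
    _ = C * (1 + y ^ 2)⁻¹ := by field_simp

/-- The Jacobian y² cancels the 1/y² of the squared lift, so w need not vanish at the origin. -/
theorem memLp_lift {w : ℝ → ℂ} (hw : RapidDecay w) : MemLp (lift w) 2 := by
  rw [memLp_two_iff_integrable_sq_norm (integrable_lift hw).1]
  refine (integrable_fun_norm_addHaar (volume : Measure R3)
    (f := fun s => ‖w s / (s : ℂ)‖ ^ 2)).2 ?_
  obtain ⟨C, hC0, hC⟩ := hw.norm_le 1
  have hm := hw.continuous.measurable
  refine ((integrable_inv_one_add_sq.const_mul (C ^ 2)).integrableOn).mono' (by fun_prop) ?_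
  filter_upwards [ae_restrict_mem measurableSet_Ioi] with y (hy : 0 < y)
  have h1 : ‖y ^ (Module.finrank ℝ R3 - 1) • ‖w y / (y : ℂ)‖ ^ 2‖ = ‖w y‖ ^ 2 := by
    simp [abs_of_pos hy]
    field_simp
  rw [h1]
  have h2 : ((1 + y ^ 2)⁻¹ : ℝ) ≤ 1 := inv_le_one_of_one_le₀ (by nlinarith [sq_nonneg y])
  have h3 : (0 : ℝ) < (1 + y ^ 2)⁻¹ := by positivity
  calc ‖w y‖ ^ 2 ≤ (C * ((1 + y ^ 2) ^ 1)⁻¹) ^ 2 := by gcongr; exact hC y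
    _ = C ^ 2 * ((1 + y ^ 2)⁻¹ * (1 + y ^ 2)⁻¹) := by rw [pow_one]; ring
    _ ≤ C ^ 2 * ((1 + y ^ 2)⁻¹ * 1) := by gcongr
    _ = C ^ 2 * (1 + y ^ 2)⁻¹ := by rw [mul_one]

theorem fourierInv_lift_ae_eq {w : ℝ → ℂ} (hw : RapidDecay w) (hodd : ∀ s, w (-s) = -w s) :
    ((𝓕⁻ ((memLp_lift hw).toLp (lift w)) : L2R3) : R3 → ℂ) =ᵐ[volume]
      fun x => -Complex.I * lift (𝓕⁻ w) x := by
  filter_upwards [fourierInv_toLp_ae_eq (integrable_lift hw) (memLp_lift hw),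
    (measure_singleton (0 : R3) : volume {(0 : R3)} = 0) |> compl_mem_ae_iff.2] with x hx hx0
  rw [hx]
  exact fourierInv_radial hw.continuous hodd hw.integrable (integrable_lift hw) hx0

/-- Square integrability is inherited through the unitarity of the `L²` transform; no decay of `𝓕⁻
w` has to be proved. -/
theorem memLp_lift_fourierInv {w : ℝ → ℂ} (hw : RapidDecay w) (hodd : ∀ s, w (-s) = -w s) :
    MemLp (lift (𝓕⁻ w)) 2 := by
  refine ((Lp.memLp (𝓕⁻ ((memLp_lift hw).toLp (lift w)) : L2R3)).const_mul Complex.I).ae_eq ?_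
  filter_upwards [fourierInv_lift_ae_eq hw hodd] with x hx
  rw [hx]
  linear_combination -lift (𝓕⁻ w) x * Complex.I_sq

theorem fourierL2_symm_lift {w : ℝ → ℂ} (hw : RapidDecay w) (hodd : ∀ s, w (-s) = -w s) :
    fourierL2.symm ((memLp_lift hw).toLp (lift w)) =
      -Complex.I • (memLp_lift_fourierInv hw hodd).toLp (lift (𝓕⁻ w)) := by
  rw [← MemLp.toLp_const_smul]
  refine Lp.ext ?_
  refine (fourierInv_lift_ae_eq hw hodd).trans ?_
  exact (MemLp.coeFn_toLp _).symm

theorem fourierL2_lift {w : ℝ → ℂ} (hw : RapidDecay w) (hodd : ∀ s, w (-s) = -w s) :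
    fourierL2 ((memLp_lift_fourierInv hw hodd).toLp (lift (𝓕⁻ w))) =
      Complex.I • (memLp_lift hw).toLp (lift w) := by
  rw [← LinearEquiv.eq_symm_apply, map_smul, fourierL2_symm_lift hw hodd, smul_smul]
  simp

/-! ### The eigenfunction -/

theorem memLp_lift_u (m : ℝ) : MemLp (lift (u m)) 2 := by
  rw [← fourierInv_uHat]
  exact memLp_lift_fourierInv (rapidDecay_uHat m) (uHat_neg m)

theorem memLp_lift_kineticU {m : ℝ} (hm : 0 < m) : MemLp (lift (kineticU m)) 2 := by
  rw [kineticU_eq_fourierInv hm]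
  exact memLp_lift_fourierInv (rapidDecay_kHat m) (kHat_neg m)

theorem fourierL2_lift_u (m : ℝ) : fourierL2 ((memLp_lift_u m).toLp (lift (u m))) =
    Complex.I • (memLp_lift (rapidDecay_uHat m)).toLp (lift (uHat m)) := by
  have h1 := fourierL2_lift (rapidDecay_uHat m) (uHat_neg m)
  simpa only [fourierInv_uHat] using h1

theorem fourierL2_symm_lift_kHat {m : ℝ} (hm : 0 < m) :
    fourierL2.symm ((memLp_lift (rapidDecay_kHat m)).toLp (lift (kHat m))) =
      -Complex.I • (memLp_lift_kineticU hm).toLp (lift (kineticU m)) := by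
  have h1 := fourierL2_symm_lift (rapidDecay_kHat m) (kHat_neg m)
  simpa only [← kineticU_eq_fourierInv hm] using h1

theorem kinetic_symbol_mul_lift_ae_eq (m : ℝ) :
    (fun ξ : R3 => ((√((2 * π * ‖ξ‖) ^ 2 + m ^ 2) - m : ℝ) : ℂ) *
      (fourierL2 ((memLp_lift_u m).toLp (lift (u m)))) ξ) =ᵐ[volume]
      Complex.I • lift (kHat m) := by
  rw [fourierL2_lift_u]
  filter_upwards [Lp.coeFn_smul Complex.I ((memLp_lift (rapidDecay_uHat m)).toLp (lift (uHat m))),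
    (memLp_lift (rapidDecay_uHat m)).coeFn_toLp] with ξ h1 h2
  rw [h1, Pi.smul_apply, h2, Pi.smul_apply, lift, lift, kHat, smul_eq_mul, smul_eq_mul]
  ring

theorem lift_u_mem_kinetic_domain (m : ℝ) :
    (memLp_lift_u m).toLp (lift (u m)) ∈ (kinetic m).domain :=
  ((memLp_lift (rapidDecay_kHat m)).const_smul Complex.I).ae_eq
    (kinetic_symbol_mul_lift_ae_eq m).symm

/-- The factor i from transforming the lift of u meets the factor -i from transforming back, leaving
the one-dimensional kinetic term lifted to ℝ³. -/
theorem kinetic_lift_u {m : ℝ} (hm : 0 < m) :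
    kinetic m ⟨(memLp_lift_u m).toLp (lift (u m)), lift_u_mem_kinetic_domain m⟩ =
      (memLp_lift_kineticU hm).toLp (lift (kineticU m)) := by
  have h1 : kinetic m ⟨(memLp_lift_u m).toLp (lift (u m)), lift_u_mem_kinetic_domain m⟩ =
      fourierL2.symm (MemLp.toLp _ (lift_u_mem_kinetic_domain m)) := rfl
  have h2 : MemLp.toLp _ (lift_u_mem_kinetic_domain m) =
      Complex.I • (memLp_lift (rapidDecay_kHat m)).toLp (lift (kHat m)) := by
    rw [← MemLp.toLp_const_smul]
    exact (MemLp.toLp_eq_toLp_iff _ _).2 (kinetic_symbol_mul_lift_ae_eq m)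
  rw [h1, h2, map_smul, fourierL2_symm_lift_kHat hm, smul_smul]
  simp

theorem W_mul_lift_u {m : ℝ} (hm : 146 ≤ m) (x : R3) :
    W m x * lift (u m) x = eigenval m * lift (u m) x - lift (kineticU m) x := by
  rw [W, lift, lift, ← mul_div_assoc, V_mul_u hm]
  ring

theorem W_mul_lift_u_ae_eq {m : ℝ} (hm : 146 ≤ m) :
    (fun x => W m x * ((memLp_lift_u m).toLp (lift (u m)) : L2R3) x) =ᵐ[volume]
      (eigenval m : ℂ) • lift (u m) - lift (kineticU m) := by
  filter_upwards [(memLp_lift_u m).coeFn_toLp] with x hx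
  rw [hx, W_mul_lift_u hm]
  rfl

theorem lift_u_mem_mulOp_domain {m : ℝ} (hm : 146 ≤ m) :
    (memLp_lift_u m).toLp (lift (u m)) ∈ (mulOp volume (W m)).domain :=
  (((memLp_lift_u m).const_smul _).sub (memLp_lift_kineticU (by linarith))).ae_eq
    (W_mul_lift_u_ae_eq hm).symm

theorem mulOp_lift_u {m : ℝ} (hm : 146 ≤ m) :
    mulOp volume (W m) ⟨(memLp_lift_u m).toLp (lift (u m)), lift_u_mem_mulOp_domain hm⟩ =
      (eigenval m : ℂ) • (memLp_lift_u m).toLp (lift (u m)) -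
        (memLp_lift_kineticU (by linarith)).toLp (lift (kineticU m)) := by
  rw [← MemLp.toLp_const_smul, ← MemLp.toLp_sub]
  exact (MemLp.toLp_eq_toLp_iff (lift_u_mem_mulOp_domain hm) _).2 (W_mul_lift_u_ae_eq hm)

theorem lift_u_mem_Hr_domain {m : ℝ} (hm : 146 ≤ m) :
    (memLp_lift_u m).toLp (lift (u m)) ∈ (Hr m).domain :=
  ⟨lift_u_mem_kinetic_domain m, lift_u_mem_mulOp_domain hm⟩

theorem Hr_lift_u {m : ℝ} (hm : 146 ≤ m) :
    Hr m ⟨(memLp_lift_u m).toLp (lift (u m)), lift_u_mem_Hr_domain hm⟩ =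
      (eigenval m : ℂ) • (memLp_lift_u m).toLp (lift (u m)) := by
  have h1 : Hr m ⟨(memLp_lift_u m).toLp (lift (u m)), lift_u_mem_Hr_domain hm⟩ =
      kinetic m ⟨(memLp_lift_u m).toLp (lift (u m)), lift_u_mem_kinetic_domain m⟩ +
      mulOp volume (W m)
        ⟨(memLp_lift_u m).toLp (lift (u m)), lift_u_mem_mulOp_domain hm⟩ := rfl
  rw [h1, kinetic_lift_u (by linarith), mulOp_lift_u hm]
  abel

theorem v_eq_smul_lift (m : ℝ) : v m = ((√(4 * π))⁻¹ : ℂ) • lift (u m) := by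
  ext x
  rw [v, Pi.smul_apply, lift, smul_eq_mul, Complex.ofReal_mul]
  ring

theorem memLp_v (m : ℝ) : MemLp (v m) 2 := by
  rw [v_eq_smul_lift]
  exact (memLp_lift_u m).const_smul _

theorem toLp_v (m : ℝ) : (memLp_v m).toLp (v m) =
    ((√(4 * π))⁻¹ : ℂ) • (memLp_lift_u m).toLp (lift (u m)) := by
  rw [← MemLp.toLp_const_smul]
  simp only [v_eq_smul_lift]

theorem toLp_v_ne_zero {m : ℝ} (hm : 146 ≤ m) : (memLp_v m).toLp (v m) ≠ 0 := by
  intro h0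
  have h1 : v m =ᵐ[volume] 0 :=
    (memLp_v m).coeFn_toLp.symm.trans (h0 ▸ Lp.coeFn_zero ℂ 2 volume)
  -- On the punctured unit ball 0 < |x| < 1 < π, so u(|x|) cannot vanish there.
  have h2 : ∀ᵐ x : R3, x ∉ Metric.ball (0 : R3) 1 := by
    filter_upwards [h1, (measure_singleton (0 : R3) : volume {(0 : R3)} = 0)
      |> compl_mem_ae_iff.2] with x hx hx0 hxb
    have hpos : 0 < ‖x‖ := norm_pos_iff.2 hx0
    rw [mem_ball_zero_iff] at hxb
    have hsin := sin_pos_of_pos_of_lt_pi hpos (by linarith [pi_gt_three])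
    have hu : u m ‖x‖ ≠ 0 := fun h => hsin.ne' ((u_eq_zero_iff hm _).1 h)
    have hs : √(4 * π) * ‖x‖ ≠ 0 := by positivity
    exact div_ne_zero hu (Complex.ofReal_ne_zero.2 hs) hx
  have h3 : (volume : Measure R3) (Metric.ball 0 1) = 0 := by
    refine measure_mono_null (fun x hx => ?_) (ae_iff.1 h2)
    exact not_not.2 hx
  exact (Metric.measure_ball_pos volume (0 : R3) one_pos).ne' h3

theorem Hr_v {m : ℝ} (hm : 146 ≤ m) : ∃ hD : (memLp_v m).toLp (v m) ∈ (Hr m).domain,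
    Hr m ⟨(memLp_v m).toLp (v m), hD⟩ = (eigenval m : ℂ) • (memLp_v m).toLp (v m) := by
  have hD : (memLp_v m).toLp (v m) ∈ (Hr m).domain := by
    rw [toLp_v]
    exact (Hr m).domain.smul_mem _ (lift_u_mem_Hr_domain hm)
  refine ⟨hD, ?_⟩
  have h1 : (⟨(memLp_v m).toLp (v m), hD⟩ : (Hr m).domain) = ((√(4 * π))⁻¹ : ℂ) •
      ⟨(memLp_lift_u m).toLp (lift (u m)), lift_u_mem_Hr_domain hm⟩ := Subtype.ext (toLp_v m)
  rw [h1, LinearPMap.map_smul, Hr_lift_u hm, toLp_v, smul_comm]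

end RelSchrodinger

theorem mainTheorem6 (m : ℝ) (hm : 146 ≤ m) :
    -- `V` is well defined: `u` vanishes only on `π ℤ`, and `V` extends there to a continuous
    -- real-valued function on the line
    ((∀ r : ℝ, RelSchrodinger.u m r = 0 ↔ ∃ n : ℤ, r = n * Real.pi) ∧
      Continuous (RelSchrodinger.V m) ∧ (∀ r : ℝ, (RelSchrodinger.V m r).im = 0)) ∧
    -- `v` is a nonzero element of `D(H_r)` and `H_r v = λ v`
    ∃ hv : MeasureTheory.MemLp (RelSchrodinger.v m) 2 MeasureTheory.volume,
      hv.toLp (RelSchrodinger.v m) ≠ 0 ∧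
      ∃ hD : hv.toLp (RelSchrodinger.v m) ∈ (RelSchrodinger.Hr m).domain,
        RelSchrodinger.Hr m ⟨hv.toLp (RelSchrodinger.v m), hD⟩ =
          ((RelSchrodinger.eigenval m : ℝ) : ℂ) • hv.toLp (RelSchrodinger.v m) := by
  refine ⟨⟨fun r => ?_, RelSchrodinger.continuous_V hm, RelSchrodinger.V_im hm⟩,
    RelSchrodinger.memLp_v m, RelSchrodinger.toLp_v_ne_zero hm, RelSchrodinger.Hr_v hm⟩
  rw [RelSchrodinger.u_eq_zero_iff hm, Real.sin_eq_zero_iff]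
  simp only [eq_comm]
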